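/- For a finite set $S\subset\mathbb{R}^2$, a dominating set of $S$ is a subset $S'\subseteq S$ such that every point of $S$ is at Euclidean distance at most $1$ from some point of $S'$; let $OPT$ be a dominating set of $S$ of minimum cardinality. Computations are on a real RAM: a program works on arrays of natural numbers and arrays of real numbers, accessed by computed indices, and each memory access, arithmetic operation ($+$ and truncated $-$ on natural numbers; $+,-,\times,/$ on reals), natural-to-real conversion, comparison and branch costs one step; program constants are natural numbers, and there is no rounding operation. There are a single algorithm (real RAM program) and an absolute constant $C$ such that, for every positive integer $k$ and every set $S$ of $n$ points in $\mathbb{R}^2$, given in any order, the algorithm on input $(k,S)$ halts after at most $\max(n,2)^{Ck}$ steps (that is, in $n^{O(k)}$ time) and outputs a dominating set $S'$ of $S$ with $$|S'|\le\Bigl(1+\frac1k\Bigr)^2\,|OPT| .$$ -/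

import Mathlib

/-! ## Dominating sets of finite planar point sets -/

/-- The Euclidean plane. -/
abbrev Plane : Type := EuclideanSpace ℝ (Fin 2)

/-- `D` is a dominating set for `S`: it is a subset of `S`, and the closed unit-radius disks
centered at the points of `D` cover `S`. -/
def IsDominatingSet (S D : Finset Plane) : Prop :=
  D ⊆ S ∧ ∀ s ∈ S, ∃ d ∈ D, dist s d ≤ 1

/-- `D` is a minimum dominating set for `S`. -/
def IsMinimumDominatingSet (S D : Finset Plane) : Prop :=
  IsDominatingSet S D ∧ ∀ D' : Finset Plane, IsDominatingSet S D' → D.card ≤ D'.card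

/-! ## A real random access machine with a step count

The memory consists of arrays of natural numbers and arrays of real numbers (a program mentions only
finitely many of them) whose cells are accessed by computed indices. Every arithmetic operation,
comparison, memory access and branch costs one step. The operations on natural numbers are addition
and truncated subtraction; those on reals are the four field operations. There is no rounding
operation from reals to integers, and the constants of a program are natural numbers. -/

namespace RealRAM

/-- The memory: `nat a i` is cell `i` of the natural-number array `a`, and `real a i` is cell `i`
of the real array `a`. -/
structure State where
  nat : ℕ → ℕ → ℕ
  real : ℕ → ℕ → ℝ

/-- Natural-number expressions; `get a i` reads the cell with index `i` of the array `a`. -/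
inductive NExp : Type
  | const (c : ℕ) : NExp
  | get (a : ℕ) (i : NExp) : NExp
  | add (e f : NExp) : NExp
  | sub (e f : NExp) : NExp

/-- Real expressions; `ofNat` converts a natural number to a real number. -/
inductive RExp : Type
  | ofNat (e : NExp) : RExp
  | get (a : ℕ) (i : NExp) : RExp
  | add (e f : RExp) : RExp
  | sub (e f : RExp) : RExp
  | mul (e f : RExp) : RExp
  | div (e f : RExp) : RExp

/-- Tests. -/
inductive BExp : Type
  | natLe (e f : NExp) : BExp
  | realLe (e f : RExp) : BExp
  | not (b : BExp) : BExp
  | and (b c : BExp) : BExp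

/-- Programs; `setNat a i e` and `setReal a i e` store the value of `e` in the cell with index `i`
of the array `a`, and `loop b p` repeats `p` as long as the test `b` succeeds. -/
inductive Prog : Type
  | skip : Prog
  | setNat (a : ℕ) (i e : NExp) : Prog
  | setReal (a : ℕ) (i : NExp) (e : RExp) : Prog
  | seq (p q : Prog) : Prog
  | ite (b : BExp) (p q : Prog) : Prog
  | loop (b : BExp) (p : Prog) : Prog

/-- The value of a natural-number expression. -/
def NExp.eval (s : State) : NExp → ℕ
  | .const c => c
  | .get a i => s.nat a (i.eval s)
  | .add e f => e.eval s + f.eval s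
  | .sub e f => e.eval s - f.eval s

/-- The number of steps that evaluating a natural-number expression takes. -/
def NExp.cost : NExp → ℕ
  | .const _ => 1
  | .get _ i => i.cost + 1
  | .add e f => e.cost + f.cost + 1
  | .sub e f => e.cost + f.cost + 1

/-- The value of a real expression; a division by zero returns `0`. -/
noncomputable def RExp.eval (s : State) : RExp → ℝ
  | .ofNat e => (e.eval s : ℝ)
  | .get a i => s.real a (i.eval s)
  | .add e f => e.eval s + f.eval s
  | .sub e f => e.eval s - f.eval s
  | .mul e f => e.eval s * f.eval s
  | .div e f => e.eval s / f.eval s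

/-- The number of steps that evaluating a real expression takes. -/
def RExp.cost : RExp → ℕ
  | .ofNat e => e.cost + 1
  | .get _ i => i.cost + 1
  | .add e f => e.cost + f.cost + 1
  | .sub e f => e.cost + f.cost + 1
  | .mul e f => e.cost + f.cost + 1
  | .div e f => e.cost + f.cost + 1

/-- The test `b` succeeds in the state `s`. -/
def BExp.Holds (s : State) : BExp → Prop
  | .natLe e f => e.eval s ≤ f.eval s
  | .realLe e f => e.eval s ≤ f.eval s
  | .not b => ¬ b.Holds s
  | .and b c => b.Holds s ∧ c.Holds s

/-- The number of steps that performing a test takes. -/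
def BExp.cost : BExp → ℕ
  | .natLe e f => e.cost + f.cost + 1
  | .realLe e f => e.cost + f.cost + 1
  | .not b => b.cost + 1
  | .and b c => b.cost + c.cost + 1

/-- Overwrite cell `i` of the natural-number array `a` with `v`. -/
def State.setNat (s : State) (a i v : ℕ) : State :=
  { s with nat := Function.update s.nat a (Function.update (s.nat a) i v) }

/-- Overwrite cell `i` of the real array `a` with `v`. -/
noncomputable def State.setReal (s : State) (a i : ℕ) (v : ℝ) : State :=
  { s with real := Function.update s.real a (Function.update (s.real a) i v) }

/-- `Runs p s t s'`: started in the state `s`, the program `p` halts after exactly `t` steps in the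
state `s'`. -/
inductive Runs : Prog → State → ℕ → State → Prop
  | skip (s : State) : Runs .skip s 1 s
  | setNat (s : State) (a : ℕ) (i e : NExp) :
      Runs (.setNat a i e) s (i.cost + e.cost + 1) (s.setNat a (i.eval s) (e.eval s))
  | setReal (s : State) (a : ℕ) (i : NExp) (e : RExp) :
      Runs (.setReal a i e) s (i.cost + e.cost + 1) (s.setReal a (i.eval s) (e.eval s))
  | seq {p q : Prog} {s₁ s₂ s₃ : State} {t u : ℕ} :
      Runs p s₁ t s₂ → Runs q s₂ u s₃ → Runs (.seq p q) s₁ (t + u) s₃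
  | iteTrue {b : BExp} {p q : Prog} {s s' : State} {t : ℕ} :
      b.Holds s → Runs p s t s' → Runs (.ite b p q) s (b.cost + 1 + t) s'
  | iteFalse {b : BExp} {p q : Prog} {s s' : State} {t : ℕ} :
      ¬ b.Holds s → Runs q s t s' → Runs (.ite b p q) s (b.cost + 1 + t) s'
  | loopFalse {b : BExp} {p : Prog} {s : State} :
      ¬ b.Holds s → Runs (.loop b p) s (b.cost + 1) s
  | loopTrue {b : BExp} {p : Prog} {s₁ s₂ s₃ : State} {t u : ℕ} :
      b.Holds s₁ → Runs p s₁ t s₂ → Runs (.loop b p) s₂ u s₃ →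
        Runs (.loop b p) s₁ (b.cost + 1 + t + u) s₃

/-- The input `(k, S)`, where `S` is the set of the `n` distinct points `p 0, …, p (n - 1)`:
natural-number array `0` starts with `n` and `k`, real arrays `0` and `1` start with the `n` first
and the `n` second coordinates of the points, and all other cells hold `0`. -/
noncomputable def input (k : ℕ) {n : ℕ} (p : Fin n ↪ Plane) : State where
  nat a i := if a = 0 ∧ i = 0 then n else if a = 0 ∧ i = 1 then k else 0
  real a i :=
    if h : i < n then
      if a = 0 then p ⟨i, h⟩ 0 else if a = 1 then p ⟨i, h⟩ 1 else 0
    else 0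

/-- The set of points that a final state describes as the output: the points `p i` for which cell
`i` of natural-number array `1` holds `1`. -/
def output {n : ℕ} (p : Fin n ↪ Plane) (s : State) : Finset Plane :=
  (Finset.univ.filter fun i : Fin n => s.nat 1 i = 1).map p

end RealRAM

/-! ## Strip decompositions of a dominating set problem -/

namespace StripDominating

open Finset

/-! The argument is a shifting strategy in one direction only, combined with an exact sweep inside
each horizontal strip.

Cut the plane into strips of height `2 * k`, with one of `k` offsets that are multiples of 2. A unit
disk has height 2, so for all but at most one offset its centre serves a single strip, and for the
remaining one it serves at most two. Averaging over the offsets (`exists_shift`) yields one for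
which the parts of a dominating set `D` serving the separate strips have total size at most `(1 + 1
/ k) * |D|`. Solving the strips loses nothing further, so the second factor of the stated ratio is
slack.

Within a strip, a smallest set dominating its points has at most `36 * k` elements in any vertical
slab of width 2: the points they dominate lie in a box of size 4 by `2 * k`, and one representative
per grid cell of side 1/2 would dominate them as well (`exists_dominating_sparse`). Hence a sweep
from left to right has to remember only the chosen points of the last slab, the window. For each
window the smallest partial solution suffices (`Instance.Sorted.candidate_next`, which rests on
`Instance.Sorted.covers_next`), and the number of windows is at most `(n + 1) ^ (64 * k)`
(`Segment.sub_le`).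

Without rounding, the machine cannot form the strips. Instead a dynamic program over the ranks of
the ordinates tries every interval `[i, j)` of ranks as a strip. The true strips are among these, so
every table that satisfies the recursive inequality is within the factor `1 + 1 / k`
(`strip_dp_le`).

The program is verified in a Hoare logic for total correctness, `Reaches`, that carries a step
bound. With `N = (n + 1) ^ (64 * k)`, the bound is of order `n ^ 2` intervals, times `n + 1` sweep
steps, times `N` list entries, times `(n + 1) ^ 2 + N` for testing and inserting one set;
`time_bound` turns this into the required power. -/

/-- The points with coordinates `(X d, Y d)` and `(X r, Y r)` are at distance at most `1`. -/
def Adj (X Y : ℕ → ℝ) (d r : ℕ) : Prop :=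
  (X d - X r) * (X d - X r) + (Y d - Y r) * (Y d - Y r) ≤ 1

lemma Adj.refl (X Y : ℕ → ℝ) (d : ℕ) : Adj X Y d d := by simp [Adj]

lemma Adj.abs_fst {X Y : ℕ → ℝ} {d r : ℕ} (h : Adj X Y d r) : |X d - X r| ≤ 1 := by
  unfold Adj at h
  exact abs_le_one_iff_mul_self_le_one.2 (by linarith [mul_self_nonneg (Y d - Y r)])

lemma Adj.abs_snd {X Y : ℕ → ℝ} {d r : ℕ} (h : Adj X Y d r) : |Y d - Y r| ≤ 1 := by
  unfold Adj at h
  exact abs_le_one_iff_mul_self_le_one.2 (by linarith [mul_self_nonneg (X d - X r)])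

/-- `D` dominates the point `r`. -/
def Dominates (X Y : ℕ → ℝ) (D : Finset ℕ) (r : ℕ) : Prop := ∃ d ∈ D, Adj X Y d r

/-! ### Windows, and the sparsity of minimum sets -/

/-- The elements of `D` that are at most `2` to the left of point `m`. -/
noncomputable def window (X : ℕ → ℝ) (m : ℕ) (D : Finset ℕ) : Finset ℕ :=
  D.filter fun d => X m - 2 ≤ X d

/-- `D` dominates all the points whose `Y`-rank `R` lies in `[i, j)`, with windows of at most `B`
elements. -/
structure IsThinDominating (n : ℕ) (X Y : ℕ → ℝ) (R : ℕ → ℕ) (B i j : ℕ) (D : Finset ℕ) :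
    Prop where
  subset : D ⊆ range n
  dominates : ∀ r < n, i ≤ R r → R r < j → Dominates X Y D r
  card_window_le : ∀ m < n, (window X m (D.filter (· < m + 1))).card ≤ B

/-- Cells of side 1/2 have diameter at most `√2 / 2`, which is below the unit radius. -/
lemma adj_of_floor_eq {X Y : ℕ → ℝ} {d r : ℕ} {a b : ℝ}
    (hx : ⌊2 * (X d - a)⌋ = ⌊2 * (X r - a)⌋) (hy : ⌊2 * (Y d - b)⌋ = ⌊2 * (Y r - b)⌋) :
    Adj X Y d r := by
  have h1 := abs_lt.1 (Int.abs_sub_lt_one_of_floor_eq_floor hx)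
  have h2 := abs_lt.1 (Int.abs_sub_lt_one_of_floor_eq_floor hy)
  unfold Adj
  nlinarith [h1.1, h1.2, h2.1, h2.2]

open Classical in
/-- A set that dominates part of a strip of height `2 * k` can be replaced by one which is at most
as large and has few elements in each vertical slab of width `2`. -/
lemma exists_dominating_sparse {n : ℕ} {X Y : ℕ → ℝ} {k : ℕ} {b : ℝ} {P D₀ : Finset ℕ}
    (hPn : P ⊆ range n) (hP : ∀ r ∈ P, b ≤ Y r ∧ Y r < b + 2 * k) (hD₀ : D₀ ⊆ range n)
    (hdom : ∀ r ∈ P, Dominates X Y D₀ r) :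
    ∃ D ⊆ range n, D.card ≤ D₀.card ∧ (∀ r ∈ P, Dominates X Y D r) ∧
      ∀ a : ℝ, (D.filter fun d => a - 2 ≤ X d ∧ X d ≤ a).card ≤ 64 * k := by
  -- Sparsity comes from minimality among all subsets of `range n` that dominate `P`, whether or not
  -- they lie inside the strip.
  obtain ⟨D, hD, hmin⟩ := Finset.exists_min_image
    ((range n).powerset.filter fun D => ∀ r ∈ P, Dominates X Y D r) Finset.card
    ⟨D₀, by simpa [hD₀] using hdom⟩
  simp only [mem_filter, mem_powerset] at hD hmin
  refine ⟨D, hD.1, hmin _ ⟨hD₀, hdom⟩, hD.2, fun a => ?_⟩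
  set W := D.filter fun d => a - 2 ≤ X d ∧ X d ≤ a with hW
  set Q := P.filter fun r => Dominates X Y W r with hQ
  -- Grid of side 1/2 anchored at the lower left corner of a box that contains every point of `P`
  -- dominated by `W`.
  let cell : ℕ → ℤ × ℤ := fun r => (⌊2 * (X r - (a - 3))⌋, ⌊2 * (Y r - b)⌋)
  -- Nine columns, not eight: the abscissae range over the closed interval `[a - 3, a + 1]`, so the
  -- scaled value 8 can occur. The ordinates range over a half-open interval, which gives `4 * k`
  -- rows.
  have hcell : Q.image cell ⊆ Finset.Ico 0 9 ×ˢ Finset.Ico 0 (4 * k : ℤ) := by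
    intro c hc
    obtain ⟨r, hr, rfl⟩ := mem_image.1 hc
    obtain ⟨hrP, d, hd, hdr⟩ := mem_filter.1 hr
    obtain ⟨-, h1, h2⟩ := mem_filter.1 hd
    have h3 := abs_le.1 hdr.abs_fst
    have h4 := hP r hrP
    simp only [cell, mem_product, Finset.mem_Ico, Int.le_floor, Int.floor_lt]
    push_cast
    refine ⟨⟨?_, ?_⟩, ?_, ?_⟩ <;> linarith [h3.1, h3.2, h4.1, h4.2]
  have hcard : (Q.image cell).card ≤ 36 * k := by
    refine (card_le_card hcell).trans (le_of_eq ?_)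
    simp [card_product]; omega
  have hrep : ∀ c ∈ Q.image cell, ∃ r ∈ Q, cell r = c := fun c hc => mem_image.1 hc
  choose! rep hrepQ hrepc using hrep
  set T := (Q.image cell).image rep with hT
  have hTcard : T.card ≤ 36 * k := card_image_le.trans hcard
  have hTn : T ⊆ range n := by
    intro r hr
    obtain ⟨c, hc, rfl⟩ := mem_image.1 hr
    exact hPn (mem_filter.1 (hrepQ c hc)).1
  have hWD : W ⊆ D := filter_subset _ _
  -- Exchange: with `W` traded for the cell representatives `T` the set still dominates `P`, so `W`
  -- has at most `36 * k` elements. The surplus up to `64 * k` is harmless; `64 * k` is what six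
  -- doublings of `k` produce in the program.
  have key := hmin ((D \ W) ∪ T)
    ⟨union_subset (sdiff_subset.trans hD.1) hTn, fun r hr => by
      obtain ⟨d, hd, hdr⟩ := hD.2 r hr
      by_cases hdW : d ∈ W
      · have hrQ : r ∈ Q := mem_filter.2 ⟨hr, d, hdW, hdr⟩
        have hc := hrepc (cell r) (mem_image_of_mem _ hrQ)
        simp only [cell, Prod.mk.injEq] at hc
        exact ⟨rep (cell r), mem_union_right _ (mem_image_of_mem _ (mem_image_of_mem _ hrQ)),
          adj_of_floor_eq hc.1 hc.2⟩
      · exact ⟨d, mem_union_left _ (mem_sdiff.2 ⟨hd, hdW⟩), hdr⟩⟩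
  have h5 := card_union_le (D \ W) T
  have h6 := card_sdiff_add_card_eq_card hWD
  omega

/-! ### Averaging over the shifts of the strips -/

lemma Int.ediv_eq_of_not_dvd_succ {a k : ℤ} (hk : 0 < k) (h : ¬ k ∣ a + 1) : (a + 1) / k = a / k := by
  rw [Int.ediv_eq_iff_of_pos hk]
  have h1 := Int.emod_add_mul_ediv a k
  have h2 := Int.emod_nonneg a hk.ne'
  have h3 := Int.emod_lt_of_pos a hk
  refine ⟨by nlinarith, ?_⟩
  rcases (show a % k + 1 ≤ k by omega).lt_or_eq with h4 | h4
  · nlinarith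
  · exact absurd ⟨a / k + 1, by linarith⟩ h

-- The two quotients can differ only if `k` divides `g + 1 - s`, which happens for at most one `s`
-- among `k` consecutive values. All other pairs collapse to singletons.
open Classical in
lemma sum_card_pair_le {k : ℕ} (hk : 1 ≤ k) (g : ℤ) :
    ∑ s ∈ range k, ({(g - s) / (k : ℤ), (g + 1 - s) / (k : ℤ)} : Finset ℤ).card ≤ k + 1 := by
  have hk' : (0 : ℤ) < k := by exact_mod_cast hk
  calc _ ≤ ∑ s ∈ range k, (1 + if (k : ℤ) ∣ g + 1 - s then 1 else 0) := by
        refine sum_le_sum fun s _ => ?_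
        split_ifs with h
        · exact card_le_two
        · have : g + 1 - s = g - s + 1 := by ring
          rw [this] at h ⊢
          rw [Int.ediv_eq_of_not_dvd_succ hk' h]; simp
    _ = k + ((range k).filter fun s : ℕ => (k : ℤ) ∣ g + 1 - s).card := by
        rw [sum_add_distrib, ← card_filter]; simp
    _ ≤ k + 1 := by
        refine Nat.add_le_add_left (card_le_one.2 fun a ha b hb => ?_) _
        simp only [mem_filter, mem_range] at ha hb
        have h := dvd_sub hb.2 ha.2
        have h' : (k : ℤ) ∣ (a : ℤ) - b := by
          rwa [show g + 1 - (b : ℤ) - (g + 1 - a) = a - b by ring] at h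
        have := Int.eq_zero_of_abs_lt_dvd h' (by rw [abs_lt]; omega)
        omega

/-- The index of the horizontal strip of height `2 * k`, shifted by `2 * s`, containing the
ordinate `y`. -/
noncomputable def strip (k s : ℕ) (y : ℝ) : ℤ := (⌊y / 2⌋ - s) / (k : ℤ)

lemma strip_mono (k s : ℕ) : Monotone (strip k s) := fun x y h => by
  rcases k.eq_zero_or_pos with rfl | hk
  · simp [strip]
  · exact Int.ediv_le_ediv (by exact_mod_cast hk)
      (sub_le_sub_right (Int.floor_mono (by linarith)) _)

lemma strip_bounds {k s : ℕ} (hk : 1 ≤ k) {y : ℝ} {t : ℤ} (h : strip k s y = t) :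
    2 * ((t : ℝ) * k + s) ≤ y ∧ y < 2 * ((t : ℝ) * k + s) + 2 * k := by
  have hk' : (0 : ℤ) < k := by exact_mod_cast hk
  rw [strip, Int.ediv_eq_iff_of_pos hk'] at h
  obtain ⟨h1, h2⟩ := h
  have h3 : t * k + s ≤ ⌊y / 2⌋ := by linarith
  have h4 : ⌊y / 2⌋ < t * k + s + k := by linarith
  rw [Int.le_floor] at h3
  rw [Int.floor_lt] at h4
  push_cast at h3 h4
  constructor <;> linarith

open Classical in
/-- The elements of `D` that dominate a point in strip `t`. -/
noncomputable def stripPart (n : ℕ) (X Y : ℕ → ℝ) (k s : ℕ) (D : Finset ℕ) (t : ℤ) : Finset ℕ :=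
  D.filter fun d => ∃ r < n, strip k s (Y r) = t ∧ Adj X Y d r

open Classical in
/-- Some shift of the strips splits a set of `D.card` points into parts of total size at most
`(1 + 1 / k) * D.card`. -/
lemma exists_shift (n : ℕ) (X Y : ℕ → ℝ) {k : ℕ} (hk : 1 ≤ k) (D : Finset ℕ) :
    ∃ s, k * ∑ t ∈ (range n).image (fun r => strip k s (Y r)), (stripPart n X Y k s D t).card
      ≤ (k + 1) * D.card := by
  let f : ℕ → ℕ := fun s =>
    ∑ t ∈ (range n).image (fun r => strip k s (Y r)), (stripPart n X Y k s D t).card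
  have hsum : ∑ s ∈ range k, f s ≤ (k + 1) * D.card := by
    calc ∑ s ∈ range k, f s
        ≤ ∑ s ∈ range k, ∑ d ∈ D, ({(⌊(Y d - 1) / 2⌋ - s) / (k : ℤ),
            (⌊(Y d - 1) / 2⌋ + 1 - s) / (k : ℤ)} : Finset ℤ).card := by
          refine sum_le_sum fun s _ => ?_
          simp only [f, stripPart, card_filter]
          rw [sum_comm]
          refine sum_le_sum fun d _ => ?_
          rw [← card_filter]
          refine card_le_card fun t ht => ?_
          obtain ⟨-, r, hr, rfl, hdr⟩ := mem_filter.1 ht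
          have h := abs_le.1 hdr.abs_snd
          -- The ordinates dominated by `d` span length 2, so their halves have one of two
          -- consecutive floors.
          have h1 : ⌊(Y d - 1) / 2⌋ ≤ ⌊Y r / 2⌋ := Int.floor_mono (by linarith [h.1, h.2])
          have h2 : ⌊Y r / 2⌋ ≤ ⌊(Y d - 1) / 2⌋ + 1 := by
            rw [← Int.floor_add_one]; exact Int.floor_mono (by linarith [h.1, h.2])
          rw [mem_insert, mem_singleton, strip]
          rcases h1.eq_or_lt with h3 | h3
          · left; rw [h3]
          · right; rw [show ⌊Y r / 2⌋ = ⌊(Y d - 1) / 2⌋ + 1 by omega]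
      _ = ∑ d ∈ D, ∑ s ∈ range k, ({(⌊(Y d - 1) / 2⌋ - s) / (k : ℤ),
            (⌊(Y d - 1) / 2⌋ + 1 - s) / (k : ℤ)} : Finset ℤ).card := sum_comm
      _ ≤ ∑ d ∈ D, (k + 1) := sum_le_sum fun d _ => sum_card_pair_le hk _
      _ = (k + 1) * D.card := by simp [mul_comm]
  -- The best shift is no worse than the average over the `k` shifts.
  obtain ⟨s, hs, h⟩ := exists_min_image (range k) f ⟨0, mem_range.2 hk⟩
  refine ⟨s, le_trans ?_ hsum⟩
  calc k * f s = ∑ _s ∈ range k, f s := by simp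
    _ ≤ _ := sum_le_sum fun s' hs' => h s' hs'

/-! ### From strips to a recursion over ranks -/

lemma window_filter_subset {n : ℕ} {X : ℕ → ℝ} (hX : ∀ a b, a ≤ b → b < n → X a ≤ X b) {m : ℕ}
    (hm : m < n) (D : Finset ℕ) :
    window X m (D.filter (· < m + 1)) ⊆ D.filter fun d => X m - 2 ≤ X d ∧ X d ≤ X m := by
  intro d hd
  simp only [window, mem_filter] at hd ⊢
  exact ⟨hd.1.1, hd.2, hX _ _ (by omega) hm⟩

open Classical in
/-- The values of a dynamic program over the strips `[i, j)` of ranks are within the factor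
`1 + 1 / k` of the size of any dominating set. -/
theorem strip_dp_le {n : ℕ} {X Y : ℕ → ℝ} {R : ℕ → ℕ} {k : ℕ} (hk : 1 ≤ k)
    (hX : ∀ a b, a ≤ b → b < n → X a ≤ X b)
    (hR : ∀ r < n, R r = ((range n).filter fun q => Y q < Y r).card) {U : ℕ → ℕ} (hU₀ : U 0 = 0)
    (hU : ∀ i j D, i < j → j ≤ n → IsThinDominating n X Y R (64 * k) i j D → U j ≤ U i + D.card)
    {D₀ : Finset ℕ} (hD₀ : D₀ ⊆ range n) (hdom : ∀ r < n, Dominates X Y D₀ r) :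
    k * U n ≤ (k + 1) * D₀.card := by
  obtain ⟨s, hs⟩ := exists_shift n X Y hk D₀
  refine le_trans (Nat.mul_le_mul_left _ ?_) hs
  set h : ℕ → ℤ := fun r => strip k s (Y r) with hh
  set c : ℤ → ℕ := fun t => (stripPart n X Y k s D₀ t).card with hc
  -- `J t` is the rank at which strip `t` starts. Equal ordinates share both rank and strip, so
  -- strips are intervals of ranks, as `hRJ` makes precise.
  let J : ℤ → ℕ := fun t => ((range n).filter fun r => h r < t).card
  have hRJ : ∀ r < n, ∀ t, R r < J t ↔ h r < t := by
    intro r hr t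
    rw [hR r hr]
    constructor
    · intro hlt
      by_contra! hge
      refine absurd (card_le_card ?_) (not_le.2 hlt)
      intro q hq
      simp only [mem_filter] at hq ⊢
      refine ⟨hq.1, lt_of_not_ge fun hle => ?_⟩
      exact absurd (strip_mono k s hle) (not_le.2 (lt_of_lt_of_le hq.2 hge))
    · intro hlt
      refine card_lt_card ⟨fun q hq => ?_, fun hsub => ?_⟩
      · simp only [mem_filter] at hq ⊢
        exact ⟨hq.1, lt_of_le_of_lt (strip_mono k s hq.2.le) hlt⟩
      · have := hsub (mem_filter.2 ⟨mem_range.2 hr, hlt⟩)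
        simp at this
  have key : ∀ N t, J t = N → U (J t) ≤ ∑ t' ∈ ((range n).image h).filter (· < t), c t' := by
    intro N
    induction N using Nat.strong_induction_on with
    | _ N ih =>
      intro t ht
      by_cases hne : ((range n).filter fun r => h r < t).Nonempty
      -- Peel off the topmost nonempty strip below `t`. Jumping over empty strips makes the cut
      -- strictly smaller, as `hU` requires `i < j`.
      · obtain ⟨q, hq, hmax⟩ := exists_max_image _ h hne
        simp only [mem_filter, mem_range] at hq hmax
        have hlt : J (h q) < J t := by
          refine card_lt_card ⟨fun r hr => ?_, fun hsub => ?_⟩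
          · simp only [mem_filter] at hr ⊢
            exact ⟨hr.1, hr.2.trans hq.2⟩
          · have := hsub (mem_filter.2 ⟨mem_range.2 hq.1, hq.2⟩)
            simp at this
        have hJn : J t ≤ n := (card_filter_le _ _).trans (by simp)
        obtain ⟨D, hDn, hDc, hDd, hDw⟩ := exists_dominating_sparse (n := n) (X := X) (Y := Y)
          (k := k) (P := (range n).filter fun r => h r = h q) (D₀ := stripPart n X Y k s D₀ (h q))
          (filter_subset _ _)
          (fun r hr => strip_bounds hk (mem_filter.1 hr).2) ((filter_subset _ _).trans hD₀)
          (fun r hr => by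
            obtain ⟨hr1, hr2⟩ := mem_filter.1 hr
            obtain ⟨d, hd, hdr⟩ := hdom r (mem_range.1 hr1)
            exact ⟨d, mem_filter.2 ⟨hd, r, mem_range.1 hr1, hr2, hdr⟩, hdr⟩)
        have h1 := hU (J (h q)) (J t) D hlt hJn
          { subset := hDn
            dominates := fun r hr hir hrj => by
              have h2 := (hRJ r hr t).1 hrj
              have h3 := (hRJ r hr (h q)).not.1 (not_lt.2 hir)
              exact hDd r (mem_filter.2 ⟨mem_range.2 hr, le_antisymm (hmax r ⟨hr, h2⟩)
                (not_lt.1 h3)⟩)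
            card_window_le := fun m hm =>
              (card_le_card (window_filter_subset hX hm D)).trans (hDw _) }
        have h2 := ih _ (ht ▸ hlt) (h q) rfl
        have h3 : insert (h q) (((range n).image h).filter (· < h q)) ⊆
            ((range n).image h).filter (· < t) := by
          intro t' ht'
          rcases mem_insert.1 ht' with rfl | ht'
          · exact mem_filter.2 ⟨mem_image_of_mem _ (mem_range.2 hq.1), hq.2⟩
          · exact mem_filter.2 ⟨(mem_filter.1 ht').1, (mem_filter.1 ht').2.trans hq.2⟩
        have h4 := sum_le_sum_of_subset (f := c) h3
        rw [sum_insert (by simp)] at h4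
        have h5 : D.card ≤ c (h q) := hDc
        omega
      · have : J t = 0 := by
          simp only [J, card_eq_zero]; exact not_nonempty_iff_eq_empty.1 hne
        rw [this, hU₀]; exact Nat.zero_le _
  obtain ⟨t, ht⟩ : ∃ t, ∀ r < n, h r < t := by
    obtain ⟨M, hM⟩ := ((range n).image h).bddAbove
    exact ⟨M + 1, fun r hr => Int.lt_add_one_of_le
      (hM (mem_coe.2 (mem_image_of_mem _ (mem_range.2 hr))))⟩
  have hJ : J t = n := by
    simp only [J]
    rw [filter_true_of_mem fun r hr => ht r (mem_range.1 hr)]; simp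
  have := key _ t rfl
  rw [hJ] at this
  exact this.trans (sum_le_sum_of_subset (filter_subset _ _))

end StripDominating

/-! ## Total correctness with step bounds for real RAM programs -/

namespace RealRAM

open Finset StripDominating

/-- Started in `s`, the program `p` halts within `T` steps in a state satisfying `Q`. -/
def Reaches (p : Prog) (s : State) (T : ℕ) (Q : State → Prop) : Prop :=
  ∃ t s', Runs p s t s' ∧ t ≤ T ∧ Q s'

namespace Reaches

variable {p q : Prog} {s : State} {T T' : ℕ} {Q Q' : State → Prop}

lemma mono (h : Reaches p s T Q) (hT : T ≤ T') (hQ : ∀ s', Q s' → Q' s') : Reaches p s T' Q' := by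
  obtain ⟨t, s', h1, h2, h3⟩ := h
  exact ⟨t, s', h1, h2.trans hT, hQ _ h3⟩

lemma of_le (hT : T ≤ T') (h : Reaches p s T Q) : Reaches p s T' Q := h.mono hT fun _ => id

lemma imp (h : Reaches p s T Q) (hQ : ∀ s', Q s' → Q' s') : Reaches p s T Q' := h.mono le_rfl hQ

lemma skip (h : Q s) : Reaches .skip s 1 Q := ⟨_, _, .skip s, le_rfl, h⟩

lemma setNat {a : ℕ} {i e : NExp} (h : Q (s.setNat a (i.eval s) (e.eval s))) :
    Reaches (.setNat a i e) s (i.cost + e.cost + 1) Q := ⟨_, _, .setNat s a i e, le_rfl, h⟩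

lemma setReal {a : ℕ} {i : NExp} {e : RExp} (h : Q (s.setReal a (i.eval s) (e.eval s))) :
    Reaches (.setReal a i e) s (i.cost + e.cost + 1) Q := ⟨_, _, .setReal s a i e, le_rfl, h⟩

lemma seq (h : Reaches p s T fun s' => Reaches q s' T' Q) : Reaches (.seq p q) s (T + T') Q := by
  obtain ⟨t, s', h1, h2, u, s'', h3, h4, h5⟩ := h
  exact ⟨_, _, .seq h1 h3, Nat.add_le_add h2 h4, h5⟩

lemma ite {b : BExp} (h₁ : b.Holds s → Reaches p s T Q) (h₂ : ¬ b.Holds s → Reaches q s T' Q) :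
    Reaches (.ite b p q) s (b.cost + 1 + max T T') Q := by
  by_cases hb : b.Holds s
  · obtain ⟨t, s', h1, h2, h3⟩ := h₁ hb
    exact ⟨_, _, .iteTrue hb h1, by omega, h3⟩
  · obtain ⟨t, s', h1, h2, h3⟩ := h₂ hb
    exact ⟨_, _, .iteFalse hb h1, by omega, h3⟩

/-- The index of `I` is fuel. An iteration may consume several units, as when `trace` jumps down the
table, and the loop may end with fuel to spare; each unit is charged one body and one test. -/
lemma loop {b : BExp} (I : ℕ → State → Prop) (h₀ : ∀ s, I 0 s → ¬ b.Holds s ∧ Q s)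
    (hI : ∀ j s, I (j + 1) s → (¬ b.Holds s ∧ Q s) ∨
      (b.Holds s ∧ Reaches p s T fun s' => ∃ i ≤ j, I i s')) (j : ℕ) (h : I j s) :
    Reaches (.loop b p) s (j * (T + b.cost + 1) + (b.cost + 1)) Q := by
  induction j using Nat.strong_induction_on generalizing s with
  | _ j ih =>
    rcases j with _ | j
    · exact ⟨_, _, .loopFalse (h₀ s h).1, by omega, (h₀ s h).2⟩
    · rcases hI j s h with ⟨h1, h2⟩ | ⟨h1, t, s', h2, h3, i, hij, h4⟩
      · exact ⟨_, _, .loopFalse h1, by nlinarith, h2⟩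
      · obtain ⟨u, s'', h5, h6, h7⟩ := ih i (by omega) h4
        refine ⟨_, _, .loopTrue h1 h2 h5, ?_, h7⟩
        have : i * (T + b.cost + 1) ≤ j * (T + b.cost + 1) := Nat.mul_le_mul_right _ hij
        rw [add_mul j 1]
        omega

end Reaches

/-! ### Variables, counting loops and frame conditions -/

/-- The natural-number variable stored in cell `0` of the array `a`. -/
abbrev var (a : ℕ) : NExp := .get a (.const 0)

/-- Assignment to the variable stored in cell `0` of the array `a`. -/
abbrev assign (a : ℕ) (e : NExp) : Prog := .setNat a (.const 0) e

/-- Run `p` for the values of the variable `x` from `a` to `b - 1`. -/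
def forTo (x : ℕ) (a b : NExp) (p : Prog) : Prog :=
  .seq (assign x a) (.loop (.natLe (.add (var x) (.const 1)) b)
    (.seq p (assign x (.add (var x) (.const 1)))))

@[simp] lemma State.setNat_nat_self (s : State) (a i v : ℕ) :
    (s.setNat a i v).nat a = Function.update (s.nat a) i v := by simp [State.setNat]

@[simp] lemma State.setNat_nat_of_ne (s : State) {a b : ℕ} (i v : ℕ) (h : b ≠ a) :
    (s.setNat a i v).nat b = s.nat b := by simp [State.setNat, h]

@[simp] lemma State.setNat_real (s : State) (a i v : ℕ) : (s.setNat a i v).real = s.real := rfl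

@[simp] lemma State.setReal_real_self (s : State) (a i : ℕ) (v : ℝ) :
    (s.setReal a i v).real a = Function.update (s.real a) i v := by simp [State.setReal]

@[simp] lemma State.setReal_real_of_ne (s : State) {a b : ℕ} (i : ℕ) (v : ℝ) (h : b ≠ a) :
    (s.setReal a i v).real b = s.real b := by simp [State.setReal, h]

@[simp] lemma State.setReal_nat (s : State) (a i : ℕ) (v : ℝ) : (s.setReal a i v).nat = s.nat := rfl

attribute [simp] NExp.eval RExp.eval BExp.Holds NExp.cost RExp.cost BExp.cost

/-- The expression `b` is evaluated anew at every test, hence `hN`. The body has to leave the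
counter alone, and the invariant is demanded after the increment. The constant 12 pays for the
increment and the rest of the test. -/
lemma Reaches.forTo {x : ℕ} {a b : NExp} {p : Prog} {s : State} {T A N : ℕ} {Q : State → Prop}
    (I : ℕ → State → Prop) (hA : a.eval s = A) (hAN : A ≤ N) (h₀ : I A (s.setNat x 0 A))
    (hN : ∀ i st, I i st → b.eval st = N)
    (hp : ∀ i st, A ≤ i → i < N → st.nat x 0 = i → I i st →
      Reaches p st T fun s' => s'.nat x 0 = i ∧ I (i + 1) (s'.setNat x 0 (i + 1)))
    (hQ : ∀ st, st.nat x 0 = N → I N st → Q st) :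
    Reaches (forTo x a b p) s ((N - A) * (T + b.cost + 12) + a.cost + b.cost + 8) Q := by
  have key := Reaches.loop (b := .natLe (.add (var x) (.const 1)) b)
    (p := .seq p (assign x (.add (var x) (.const 1)))) (T := T + 6) (Q := Q)
    (s := s.setNat x 0 A)
    (fun j st => j + st.nat x 0 = N ∧ A ≤ st.nat x 0 ∧ I (st.nat x 0) st)
    (fun st ⟨h1, h2, h3⟩ => by
      have := hN _ _ h3
      refine ⟨by simp [this]; omega, hQ _ (by omega) ?_⟩
      rwa [show st.nat x 0 = N by omega] at h3)
    (fun j st ⟨h1, h2, h3⟩ => by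
      have := hN _ _ h3
      refine Or.inr ⟨by simp [this]; omega, Reaches.seq ((hp _ _ h2 (by omega) rfl h3).imp ?_)⟩
      rintro s' ⟨h4, h5⟩
      refine Reaches.setNat ⟨j, le_rfl, ?_⟩
      simp only [NExp.eval, h4]
      simp only [State.setNat_nat_self, Function.update_self]
      exact ⟨by omega, by omega, h5⟩)
    (N - A) (by simp only [State.setNat_nat_self, Function.update_self]; exact ⟨by omega, le_rfl, h₀⟩)
  rw [show s.setNat x 0 A = s.setNat x ((NExp.const 0).eval s) (a.eval s) by rw [hA]; rfl] at key
  refine Reaches.of_le ?_ (Reaches.seq (Reaches.setNat key))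
  simp only [NExp.cost, BExp.cost]
  have : T + 6 + (1 + 1 + 1 + 1 + b.cost + 1) + 1 = T + b.cost + 12 := by ring
  rw [this]
  omega

/-- The states `s` and `s'` differ at most in the natural-number arrays in `l`. -/
structure Frame (l : List ℕ) (s s' : State) : Prop where
  real : s'.real = s.real
  nat : ∀ a, a ∉ l → s'.nat a = s.nat a

lemma Frame.refl (l : List ℕ) (s : State) : Frame l s s := ⟨rfl, fun _ _ => rfl⟩

lemma Frame.trans {l l₁ l₂ : List ℕ} {s₁ s₂ s₃ : State} (h : Frame l₁ s₁ s₂) (h' : Frame l₂ s₂ s₃)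
    (h₁ : l₁ ⊆ l) (h₂ : l₂ ⊆ l) : Frame l s₁ s₃ :=
  ⟨h'.real.trans h.real, fun a ha =>
    (h'.nat a fun h => ha (h₂ h)).trans (h.nat a fun h => ha (h₁ h))⟩

lemma Frame.setNat {l : List ℕ} {s s' : State} (h : Frame l s s') {a : ℕ} (ha : a ∈ l) (i v : ℕ) :
    Frame l s (s'.setNat a i v) :=
  ⟨h.real, fun b hb => by
    rw [State.setNat_nat_of_ne _ _ _ (ne_of_mem_of_not_mem ha hb).symm]; exact h.nat b hb⟩

/-! ### Finite sets as bit masks -/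

/-- The number whose binary digits are the indicator function of `D`. -/
def mask (D : Finset ℕ) : ℕ := ∑ d ∈ D, 2 ^ d

@[simp] lemma mask_empty : mask ∅ = 0 := rfl

lemma mask_insert {D : Finset ℕ} {d : ℕ} (h : d ∉ D) : mask (insert d D) = mask D + 2 ^ d := by
  rw [mask, sum_insert h, add_comm]; rfl

lemma mask_injective : Function.Injective mask := geomSum_injective le_rfl

lemma mask_lt {D : Finset ℕ} {m : ℕ} (h : ∀ d ∈ D, d < m) : mask D < 2 ^ m := Nat.geomSum_lt le_rfl h

lemma mask_range (n : ℕ) : mask (range n) = 2 ^ n - 1 := by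
  simpa [mask] using Nat.geomSum_eq le_rfl n

local infixr:60 " ;; " => Prog.seq

/-! ## The program

Names for the arrays of natural numbers and for the arrays of reals that the program uses. The
sorted points are stored in the real arrays `rX` and `rY`, and `cIdx` holds their input indices. -/

local notation "cOut" => (1 : ℕ)
local notation "cIdx" => (2 : ℕ)
local notation "cPow" => (3 : ℕ)
local notation "cRank" => (4 : ℕ)
local notation "cBound" => (5 : ℕ)
local notation "cVal" => (6 : ℕ)
local notation "cPrev" => (7 : ℕ)
local notation "cSol" => (8 : ℕ)
local notation "cMask" => (9 : ℕ)
local notation "cSig" => (10 : ℕ)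
local notation "cSize" => (11 : ℕ)
local notation "cBit" => (12 : ℕ)
local notation "cJ" => (13 : ℕ)
local notation "cI" => (14 : ℕ)
local notation "cM" => (15 : ℕ)
local notation "cLo" => (16 : ℕ)
local notation "cHi" => (17 : ℕ)
local notation "cTop" => (18 : ℕ)
local notation "cE" => (19 : ℕ)
local notation "cV" => (20 : ℕ)
local notation "cW" => (21 : ℕ)
local notation "cX" => (22 : ℕ)
local notation "cCount" => (23 : ℕ)
local notation "cSg" => (24 : ℕ)
local notation "cSgCount" => (25 : ℕ)
local notation "cOk" => (26 : ℕ)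
local notation "cR" => (27 : ℕ)
local notation "cD" => (28 : ℕ)
local notation "cF" => (29 : ℕ)
local notation "cPos" => (30 : ℕ)
local notation "cQ" => (31 : ℕ)

local notation "rX" => (2 : ℕ)
local notation "rY" => (3 : ℕ)
local notation "stepVars" => ([16, 17, 18, 19, 20, 21, 22, 23, 24, 25, 26, 27, 28, 29, 30, 31, 9, 10,
  11, 12] : List ℕ)
local notation "relaxVars" => ([6, 7, 8, 12, 20, 21, 22, 23, 24, 25, 26, 27, 28, 29] : List ℕ)

/-! ### Decoding bit masks -/

/-- Decode the bit mask `cV`, and compute its size, its signature, and the size of the signature. -/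
def scan : Prog :=
  assign cW (var cV) ;; assign cCount (.const 0) ;; assign cSg (.const 0) ;;
  assign cSgCount (.const 0) ;;
  forTo cX (.const 0) (var 0)
    (assign cD (.sub (var 0) (.add (var cX) (.const 1))) ;;
    .ite (.natLe (.get cPow (var cD)) (var cW))
      (assign cW (.sub (var cW) (.get cPow (var cD))) ;;
      .setNat cBit (var cD) (.const 1) ;;
      assign cCount (.add (var cCount) (.const 1)) ;;
      .ite (.realLe (.sub (.get rX (var cM)) (.ofNat (.const 2))) (.get rX (var cD)))
        (assign cSg (.add (var cSg) (.get cPow (var cD))) ;;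
        assign cSgCount (.add (var cSgCount) (.const 1)))
        .skip)
      (.setNat cBit (var cD) (.const 0)))

lemma filter_le_eq_insert {D : Finset ℕ} {y : ℕ} (h : y ∈ D) :
    D.filter (· ≤ y) = insert y (D.filter (· < y)) := by
  ext d; simp only [mem_filter, mem_insert, le_iff_eq_or_lt]; grind

lemma filter_le_eq_lt {D : Finset ℕ} {y : ℕ} (h : y ∉ D) :
    D.filter (· ≤ y) = D.filter (· < y) := by
  ext d; simp only [mem_filter, le_iff_eq_or_lt]; grind

lemma filter_ge_eq_insert {D : Finset ℕ} {y : ℕ} (h : y ∈ D) :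
    D.filter (y ≤ ·) = insert y (D.filter (y < ·)) := by
  ext d; simp only [mem_filter, mem_insert, le_iff_eq_or_lt]; grind

lemma filter_ge_eq_gt {D : Finset ℕ} {y : ℕ} (h : y ∉ D) :
    D.filter (y ≤ ·) = D.filter (y < ·) := by
  ext d; simp only [mem_filter, le_iff_eq_or_lt]; grind

/-- The elements below `y` contribute less than `2 ^ y` in total, so the leading bit is read by one
comparison. Only addition, subtraction and a table of powers are needed for decoding. -/
lemma two_pow_le_mask_iff {D : Finset ℕ} {y : ℕ} :
    2 ^ y ≤ mask (D.filter (· ≤ y)) ↔ y ∈ D := by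
  refine ⟨fun h => ?_, fun h => ?_⟩
  · by_contra hy
    rw [filter_le_eq_lt hy] at h
    exact absurd h (not_le.2 (mask_lt (by simp)))
  · rw [filter_le_eq_insert h, mask_insert (by simp)]
    omega

lemma window_insert (X : ℕ → ℝ) (m y : ℕ) (D : Finset ℕ) :
    window X m (insert y D) =
      if X m - 2 ≤ X y then insert y (window X m D) else window X m D := by
  simp only [window, filter_insert]

lemma scan_spec {s : State} {n : ℕ} {D : Finset ℕ} (hn : s.nat 0 0 = n)
    (hp : ∀ i ≤ n, s.nat cPow i = 2 ^ i) (hD : D ⊆ range n) (hv : s.nat cV 0 = mask D) :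
    Reaches scan s (100 * (n + 1)) fun s' =>
      Frame [cW, cCount, cSg, cSgCount, cX, cD, cBit] s s' ∧
      (∀ r < n, s'.nat cBit r = if r ∈ D then 1 else 0) ∧
      s'.nat cCount 0 = D.card ∧
      s'.nat cSg 0 = mask (window (s.real rX) (s.nat cM 0) D) ∧
      s'.nat cSgCount 0 = (window (s.real rX) (s.nat cM 0) D).card := by
  -- After `x` rounds the `x` leading bits are decoded: `cW` holds the rest of the mask, and the
  -- counters describe the elements from `n - x` on.
  let I : ℕ → State → Prop := fun x s' =>
    Frame [cW, cCount, cSg, cSgCount, cX, cD, cBit] s s' ∧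
      s'.nat cW 0 = mask (D.filter (· < n - x)) ∧
      (∀ r < n, n - x ≤ r → s'.nat cBit r = if r ∈ D then 1 else 0) ∧
      s'.nat cCount 0 = (D.filter (n - x ≤ ·)).card ∧
      s'.nat cSg 0 = mask (window (s.real rX) (s.nat cM 0) (D.filter (n - x ≤ ·))) ∧
      s'.nat cSgCount 0 = (window (s.real rX) (s.nat cM 0) (D.filter (n - x ≤ ·))).card
  apply Reaches.of_le
  rotate_left
  · iterate 4
      apply Reaches.seq
      apply Reaches.setNat
    refine Reaches.forTo I rfl (Nat.zero_le n) ?_ ?_ (T := 60) ?_ ?_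
    · have h1 : D.filter (· < n) = D := filter_true_of_mem fun d hd => mem_range.1 (hD hd)
      have h2 : D.filter (n ≤ ·) = ∅ :=
        filter_false_of_mem fun d hd => not_le.2 (mem_range.1 (hD hd))
      refine ⟨?_, ?_⟩
      · iterate 5 refine Frame.setNat ?_ (by simp) _ _
        exact Frame.refl _ _
      · simp [h1, h2, hv, window]
        omega
    · rintro i st ⟨h, -⟩
      simp [h.nat, hn]
    · rintro x st - hx hcx ⟨hf, hw, hb, hc, hs, hsc⟩
      obtain ⟨y, hy⟩ : ∃ y, n - x = y + 1 := ⟨n - x - 1, by omega⟩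
      have hy' : n - (x + 1) = y := by omega
      have hst0 : st.nat 0 0 = n := by simp [hf.nat, hn]
      have hpow : st.nat cPow y = 2 ^ y := by rw [hf.nat _ (by decide), hp _ (by omega)]
      have hst15 : st.nat cM 0 = s.nat cM 0 := by rw [hf.nat _ (by decide)]
      simp only [hy, Nat.lt_add_one_iff, Nat.add_one_le_iff] at hw hb hc hs hsc
      apply Reaches.of_le
      rotate_left
      · apply Reaches.seq
        apply Reaches.setNat
        apply Reaches.ite
        · intro hle
          simp [hcx, hst0, hy', hpow, hw, two_pow_le_mask_iff] at hle
          have h1 := mask_insert (D := D.filter (· < y)) (d := y) (by simp)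
          rw [← filter_le_eq_insert hle] at h1
          have hbits : ∀ r < n, y ≤ r → Function.update (st.nat cBit) y 1 r
              = if r ∈ D then 1 else 0 := by
            intro r hr hyr
            rcases hyr.eq_or_lt with rfl | h
            · simp [hle]
            · rw [Function.update_of_ne h.ne', hb r hr h]
          have hnot : y ∉ window (s.real rX) (s.nat cM 0) (D.filter (y < ·)) := by
            simp [window]
          iterate 3
            apply Reaches.seq
            apply Reaches.setNat
          apply Reaches.ite
          · intro hwin
            simp [hst15, hf.real, hcx, hst0, hy'] at hwin
            apply Reaches.seq
            apply Reaches.setNat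
            apply Reaches.setNat
            refine ⟨by simp [hcx], ?_, ?_⟩
            · iterate 7 refine Frame.setNat ?_ (by simp) _ _
              exact hf
            · simp [hcx, hst0, hy', hpow, hw, hc, hs, hsc, filter_ge_eq_insert hle, window_insert,
                hwin, mask_insert hnot, card_insert_of_notMem hnot]
              exact ⟨by omega, hbits⟩
          · intro hwin
            simp [hst15, hf.real, hcx, hst0, hy', -not_le] at hwin
            apply Reaches.skip
            refine ⟨by simp [hcx], ?_, ?_⟩
            · iterate 5 refine Frame.setNat ?_ (by simp) _ _
              exact hf
            · simp [hcx, hst0, hy', hpow, hw, hc, hs, hsc, filter_ge_eq_insert hle, window_insert,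
                hwin]
              exact ⟨by omega, hbits⟩
        · intro hle
          simp [hcx, hst0, hy', hpow, hw, two_pow_le_mask_iff, -not_le, -Nat.not_le] at hle
          apply Reaches.setNat
          refine ⟨by simp [hcx], ?_, ?_⟩
          · iterate 3 refine Frame.setNat ?_ (by simp) _ _
            exact hf
          · simp [hcx, hst0, hy', hw, hc, hs, hsc, filter_ge_eq_gt hle,
              filter_le_eq_lt hle]
            intro r hr hyr
            rcases hyr.eq_or_lt with rfl | h
            · simp [hle]
            · rw [Function.update_of_ne h.ne', hb r hr h]
      · simp
    · rintro st - ⟨hf, hw, hb, hc, hs, hsc⟩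
      have h1 : D.filter (n - n ≤ ·) = D := filter_true_of_mem fun d hd => by omega
      rw [h1] at hc hs hsc
      exact ⟨hf, fun r hr => hb r hr (by omega), hc, hs, hsc⟩
  · simp
    omega

/-! ### Testing coverage -/

/-- Compute in `cOk` whether the decoded set dominates all points with rank in `[cI, cJ)` that are
more than `1` to the left of point `cM`. -/
def check : Prog :=
  assign cOk (.const 1) ;;
  forTo cR (.const 0) (var 0)
    (.ite (.and (.and (.natLe (var cI) (.get cRank (var cR)))
        (.natLe (.add (.get cRank (var cR)) (.const 1)) (var cJ)))
        (.not (.realLe (.get rX (var cM)) (.add (.get rX (var cR)) (.ofNat (.const 1))))))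
      (assign cF (.const 0) ;;
      forTo cD (.const 0) (var 0)
        (.ite (.and (.natLe (.const 1) (.get cBit (var cD)))
          (.realLe (.add
            (.mul (.sub (.get rX (var cD)) (.get rX (var cR)))
              (.sub (.get rX (var cD)) (.get rX (var cR))))
            (.mul (.sub (.get rY (var cD)) (.get rY (var cR)))
              (.sub (.get rY (var cD)) (.get rY (var cR))))) (.ofNat (.const 1))))
          (assign cF (.const 1)) .skip) ;;
      .ite (.natLe (var cF) (.const 0)) (assign cOk (.const 0)) .skip)
      .skip)

/-- A point set sorted by abscissa, with the ranks of the ordinates and a bound on the windows. -/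
structure Instance where
  n : ℕ
  X : ℕ → ℝ
  Y : ℕ → ℝ
  R : ℕ → ℕ
  B : ℕ

/-- The state `s` stores the instance `P`, and the powers of `2` up to `2 ^ P.n`. -/
structure Stores (P : Instance) (s : State) : Prop where
  n : s.nat 0 0 = P.n
  pow : ∀ i ≤ P.n, s.nat cPow i = 2 ^ i
  rank : s.nat cRank = P.R
  bound : s.nat cBound 0 = P.B
  X : s.real rX = P.X
  Y : s.real rY = P.Y

lemma Stores.frame {P : Instance} {s s' : State} {l : List ℕ} (h : Stores P s) (hf : Frame l s s')
    (hl : ∀ a ∈ [0, cPow, cRank, cBound], a ∉ l := by decide) : Stores P s' where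
  n := by rw [hf.nat _ (hl _ (by simp)), h.n]
  pow := by rw [hf.nat _ (hl _ (by simp))]; exact h.pow
  rank := by rw [hf.nat _ (hl _ (by simp)), h.rank]
  bound := by rw [hf.nat _ (hl _ (by simp)), h.bound]
  X := by rw [hf.real, h.X]
  Y := by rw [hf.real, h.Y]

/-- `D` dominates all points with rank in `[i, j)` that are more than `1` to the left of `m`. -/
def Instance.Covers (P : Instance) (i j m : ℕ) (D : Finset ℕ) : Prop :=
  ∀ r < P.n, i ≤ P.R r → P.R r < j → P.X r + 1 < P.X m → Dominates P.X P.Y D r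

open Classical in
lemma check_spec {P : Instance} {s : State} {i j m : ℕ} {D : Finset ℕ} (hs : Stores P s)
    (hi : s.nat cI 0 = i) (hj : s.nat cJ 0 = j) (hm : s.nat cM 0 = m) (hD : D ⊆ range P.n)
    (hb : ∀ r < P.n, s.nat cBit r = if r ∈ D then 1 else 0) :
    Reaches check s (200 * (P.n + 1) ^ 2) fun s' =>
      Frame [cOk, cR, cF, cD] s s' ∧ s'.nat cOk 0 = if P.Covers i j m D then 1 else 0 := by
  apply Reaches.of_le
  rotate_left
  · apply Reaches.seq
    apply Reaches.setNat
    refine Reaches.forTo (fun x s' => Frame [cOk, cR, cF, cD] s s' ∧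
        s'.nat cOk 0 = if ∀ r < x, i ≤ P.R r → P.R r < j → P.X r + 1 < P.X m →
          Dominates P.X P.Y D r then 1 else 0) rfl (Nat.zero_le P.n) ?_ ?_
      (T := 70 * P.n + 80) ?_ ?_
    · refine ⟨?_, by simp⟩
      iterate 2 refine Frame.setNat ?_ (by simp) _ _
      exact Frame.refl _ _
    · rintro x st ⟨hf, -⟩
      simp [(hs.frame hf).n]
    · rintro x st - hx hcx ⟨hf, hok⟩
      have hst := hs.frame hf
      have hi' : st.nat cI 0 = i := by rw [hf.nat _ (by decide), hi]
      have hj' : st.nat cJ 0 = j := by rw [hf.nat _ (by decide), hj]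
      have hm' : st.nat cM 0 = m := by rw [hf.nat _ (by decide), hm]
      have hb' : ∀ r < P.n, st.nat cBit r = if r ∈ D then 1 else 0 := by
        rw [hf.nat _ (by decide)]; exact hb
      apply Reaches.of_le
      rotate_left
      · apply Reaches.ite
        · intro hc
          simp [hcx, hi', hj', hm', hst.rank, hst.X] at hc
          obtain ⟨⟨h1, h2⟩, h3⟩ := hc
          apply Reaches.seq
          apply Reaches.setNat
          apply Reaches.seq
          refine Reaches.forTo (fun y s' => Frame [cF, cD] st s' ∧
            s'.nat cF 0 = if ∃ d < y, d ∈ D ∧ Adj P.X P.Y d x then 1 else 0) rfl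
            (Nat.zero_le P.n) ?_ ?_ (T := 50) ?_ ?_
          · refine ⟨?_, by simp⟩
            iterate 2 refine Frame.setNat ?_ (by simp) _ _
            exact Frame.refl _ _
          · rintro y su ⟨hfu, -⟩
            simp [(hst.frame hfu).n]
          · rintro y su - hy hcy ⟨hfu, hF⟩
            have hsu := hst.frame hfu
            have hcx' : su.nat cR 0 = x := by rw [hfu.nat _ (by decide), hcx]
            have hb'' : su.nat cBit y = if y ∈ D then 1 else 0 := by
              rw [hfu.nat _ (by decide)]; exact hb' y hy
            apply Reaches.of_le
            rotate_left
            · apply Reaches.ite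
              · intro h
                simp [hcy, hcx', hb'', hsu.X, hsu.Y] at h
                have h4 : y ∈ D := by by_contra h5; simp [h5] at h
                apply Reaches.setNat
                refine ⟨by simp [hcy], ?_, ?_⟩
                · iterate 2 refine Frame.setNat ?_ (by simp) _ _
                  exact hfu
                · simp only [State.setNat_nat_of_ne _ _ _ (show (cF : ℕ) ≠ cD by decide)]
                  rw [if_pos ⟨y, Nat.lt_succ_self y, h4, h.2⟩]; simp
              · intro h
                simp [hcy, hcx', hb'', hsu.X, hsu.Y, -not_and, -not_le] at h
                apply Reaches.skip
                refine ⟨hcy, Frame.setNat hfu (by simp) _ _, ?_⟩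
                simp only [State.setNat_nat_of_ne _ _ _ (show (cF : ℕ) ≠ cD by decide), hF]
                refine if_congr ⟨fun ⟨d, hd, h5⟩ => ⟨d, by omega, h5⟩, ?_⟩ rfl rfl
                rintro ⟨d, hd, h5, h6⟩
                rcases (Nat.lt_succ_iff.1 hd).lt_or_eq with h7 | rfl
                · exact ⟨d, h7, h5, h6⟩
                · exact absurd ⟨by simp [h5], h6⟩ h
            · simp
          · rintro su - ⟨hfu, hF⟩
            have hdom : (∃ d < P.n, d ∈ D ∧ Adj P.X P.Y d x) ↔ Dominates P.X P.Y D x :=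
              ⟨fun ⟨d, _, h⟩ => ⟨d, h⟩, fun ⟨d, h⟩ => ⟨d, mem_range.1 (hD h.1), h⟩⟩
            rw [if_congr hdom rfl rfl] at hF
            have hcx' : su.nat cR 0 = x := by rw [hfu.nat _ (by decide), hcx]
            have hok' := hok
            rw [← hfu.nat cOk (by decide)] at hok'
            have hfu' : Frame [cOk, cR, cF, cD] s su := hf.trans hfu (by simp) (by simp)
            apply Reaches.ite
            · intro h
              have h4 : ¬ Dominates P.X P.Y D x := by
                intro h4; simp [hF, h4] at h
              apply Reaches.setNat
              refine ⟨by simp [hcx'], ?_, ?_⟩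
              · iterate 2 refine Frame.setNat ?_ (by simp) _ _
                exact hfu'
              · rw [if_neg fun h5 => h4 (h5 x (Nat.lt_succ_self x) h1 h2 h3)]; simp
            · intro h
              have h4 : Dominates P.X P.Y D x := by
                by_contra h4; simp [hF, h4] at h
              apply Reaches.skip
              refine ⟨hcx', Frame.setNat hfu' (by simp) _ _, ?_⟩
              simp only [State.setNat_nat_of_ne _ _ _ (show (cOk : ℕ) ≠ cR by decide), hok']
              refine if_congr ⟨fun h5 r hr => ?_, fun h5 r hr => h5 r (by omega)⟩ rfl rfl
              rcases (Nat.lt_succ_iff.1 hr).lt_or_eq with h7 | rfl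
              · exact h5 r h7
              · exact fun _ _ _ => h4
        · intro hc
          simp [hcx, hi', hj', hm', hst.rank, hst.X, -not_and, -not_lt, -not_le] at hc
          apply Reaches.skip
          refine ⟨hcx, Frame.setNat hf (by simp) _ _, ?_⟩
          simp only [State.setNat_nat_of_ne _ _ _ (show (cOk : ℕ) ≠ cR by decide), hok]
          refine if_congr ⟨fun h5 r hr => ?_, fun h5 r hr => h5 r (by omega)⟩ rfl rfl
          rcases (Nat.lt_succ_iff.1 hr).lt_or_eq with h7 | rfl
          · exact h5 r h7
          · exact fun h8 h9 h10 => absurd ⟨⟨h8, h9⟩, not_le.2 h10⟩ hc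
      · simp
        omega
    · rintro st - ⟨hf, h⟩
      exact ⟨hf, h.trans (if_congr Iff.rfl rfl rfl)⟩
  · simp
    nlinarith

/-! ### Lists of candidates keyed by their windows -/

/-- Search the list entries from `cHi` to `cTop - 1` for the signature `cSg`, and store the position
in `cPos`, or `cTop` if there is none. -/
def search : Prog :=
  assign cPos (var cTop) ;;
  forTo cQ (var cHi) (var cTop)
    (.ite (.and (.natLe (.get cSig (var cQ)) (var cSg)) (.natLe (var cSg) (.get cSig (var cQ))))
      (assign cPos (var cQ)) .skip)

lemma search_spec {s : State} {hi top : ℕ} (hhi : s.nat cHi 0 = hi) (htop : s.nat cTop 0 = top)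
    (hle : hi ≤ top) :
    Reaches search s (60 * (top - hi) + 60) fun s' => Frame [cPos, cQ] s s' ∧
      ((s'.nat cPos 0 = top ∧ ∀ e, hi ≤ e → e < top → s.nat cSig e ≠ s.nat cSg 0) ∨
        (hi ≤ s'.nat cPos 0 ∧ s'.nat cPos 0 < top ∧
          s.nat cSig (s'.nat cPos 0) = s.nat cSg 0)) := by
  apply Reaches.of_le
  rotate_left
  · apply Reaches.seq
    apply Reaches.setNat
    refine Reaches.forTo (fun x s' => Frame [cPos, cQ] s s' ∧
      ((s'.nat cPos 0 = top ∧ ∀ e, hi ≤ e → e < x → s.nat cSig e ≠ s.nat cSg 0) ∨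
        (hi ≤ s'.nat cPos 0 ∧ s'.nat cPos 0 < top ∧
          s.nat cSig (s'.nat cPos 0) = s.nat cSg 0))) (A := hi) (by simp [hhi]) hle ?_ ?_
          (T := 30) ?_ ?_
    · refine ⟨?_, ?_⟩
      · iterate 2 refine Frame.setNat ?_ (by simp) _ _
        exact Frame.refl _ _
      · simp [htop]; intros; omega
    · rintro x st ⟨hf, -⟩
      simp [hf.nat, htop]
    · rintro x st hx1 hx2 hcx ⟨hf, h⟩
      have h1 : st.nat cSig = s.nat cSig := hf.nat _ (by decide)
      have h2 : st.nat cSg = s.nat cSg := hf.nat _ (by decide)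
      apply Reaches.of_le
      rotate_left
      · apply Reaches.ite
        · intro hc
          simp [hcx, h1, h2] at hc
          apply Reaches.setNat
          refine ⟨by simp [hcx], ?_, Or.inr ?_⟩
          · iterate 2 refine Frame.setNat ?_ (by simp) _ _
            exact hf
          · simp [hcx]
            exact ⟨hx1, hx2, le_antisymm hc.1 hc.2⟩
        · intro hc
          simp [hcx, h1, h2] at hc
          apply Reaches.skip
          refine ⟨hcx, Frame.setNat hf (by simp) _ _, ?_⟩
          simp only [State.setNat_nat_of_ne _ _ _ (show (cPos : ℕ) ≠ cQ by decide)]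
          refine h.imp_left fun h3 => ⟨h3.1, fun e he1 he2 => ?_⟩
          rcases (Nat.lt_succ_iff.1 he2).lt_or_eq with h7 | rfl
          · exact h3.2 e he1 h7
          · exact fun h8 => absurd (hc h8.le) (by omega)
      · simp
    · rintro st - ⟨hf, h⟩
      exact ⟨hf, h⟩
  · simp
    omega

/-- A partial solution of the sweep over the points with rank in `[i, j)` after point `m`. -/
structure Instance.Candidate (P : Instance) (i j m : ℕ) (D : Finset ℕ) : Prop where
  subset : D ⊆ range (m + 1)
  covers : P.Covers i j m D
  card_window_le : (window P.X m D).card ≤ P.B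

/-- The entries `lo, …, hi - 1` of the list are candidates with different signatures. -/
structure Segment (P : Instance) (i j m : ℕ) (s : State) (lo hi : ℕ) : Prop where
  entry : ∀ e, lo ≤ e → e < hi → ∃ D, P.Candidate i j m D ∧ s.nat cMask e = mask D ∧
    s.nat cSig e = mask (window P.X m D) ∧ s.nat cSize e = D.card
  inj : ∀ e e', lo ≤ e → e < hi → lo ≤ e' → e' < hi → s.nat cSig e = s.nat cSig e' → e = e'

/-- Among the entries `lo, …, hi - 1` there is one with signature `g` and size at most `c`. -/
def Represented (s : State) (lo hi g c : ℕ) : Prop :=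
  ∃ e, lo ≤ e ∧ e < hi ∧ s.nat cSig e = g ∧ s.nat cSize e ≤ c

/-- A set of at most `B` elements is listed by a function on `Fin B`, with the value `n` as padding
that the final filter removes. -/
lemma card_small_subsets_le (n B : ℕ) :
    ((range n).powerset.filter fun E => E.card ≤ B).card ≤ (n + 1) ^ B := by
  calc _ ≤ ((Fintype.piFinset fun _ : Fin B => range (n + 1)).image
          fun f => (univ.image f).filter (· < n)).card := by
        refine card_le_card fun E hE => ?_
        simp only [mem_filter, mem_powerset] at hE
        refine mem_image.2 ⟨fun b => E.toList.getD b n, ?_, ?_⟩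
        · rw [Fintype.mem_piFinset]
          intro b
          rw [mem_range, List.getD_eq_getElem?_getD]
          rcases h : E.toList[(b : ℕ)]? with _ | x
          · simp
          · have := mem_range.1 (hE.1 (mem_toList.1 (List.mem_of_getElem? h)))
            simp; omega
        · ext x
          simp only [mem_filter, mem_image, mem_univ, true_and, List.getD_eq_getElem?_getD]
          constructor
          · rintro ⟨⟨b, rfl⟩, hx⟩
            rcases h : E.toList[(b : ℕ)]? with _ | x
            · simp [h] at hx
            · simpa using mem_toList.1 (List.mem_of_getElem? h)
          · intro hx
            obtain ⟨b, hb, h⟩ := List.mem_iff_getElem.1 (mem_toList.2 hx)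
            refine ⟨⟨⟨b, ?_⟩, ?_⟩, mem_range.1 (hE.1 hx)⟩
            · rw [length_toList] at hb; omega
            · simp [List.getElem?_eq_getElem hb, h]
    _ ≤ _ := card_image_le.trans (by simp)

/-- Different signatures are masks of different subsets of size at most `P.B`. This is where
sparsity turns into a bound on the length of the list. -/
lemma Segment.sub_le {P : Instance} {i j m : ℕ} {s : State} {lo hi : ℕ}
    (h : Segment P i j m s lo hi) (hm : m < P.n) : hi - lo ≤ (P.n + 1) ^ P.B := by
  classical
  refine le_trans ?_ (card_small_subsets_le P.n P.B)
  rw [← Nat.card_Ico, ← card_image_of_injective _ mask_injective]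
  refine card_le_card_of_injOn (fun e => s.nat cSig e) (fun e he => ?_) (fun e he e' he' hee => ?_)
  · obtain ⟨he1, he2⟩ := Finset.mem_Ico.1 he
    obtain ⟨D, hD, -, h1, -⟩ := h.entry e he1 he2
    refine mem_image.2 ⟨_, mem_filter.2 ⟨mem_powerset.2 ?_, hD.card_window_le⟩, h1.symm⟩
    exact (filter_subset _ _).trans (hD.subset.trans (range_subset_range.2 (by omega)))
  · obtain ⟨he1, he2⟩ := Finset.mem_Ico.1 he
    obtain ⟨he1', he2'⟩ := Finset.mem_Ico.1 he'
    exact h.inj _ _ he1 he2 he1' he2' hee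

/-- Write the set `cV` to position `cPos` of the list. -/
def store : Prog :=
  .setNat cMask (var cPos) (var cV) ;; .setNat cSig (var cPos) (var cSg) ;;
  .setNat cSize (var cPos) (var cCount)

/-- Add the set `cV` to the list, unless it is not a candidate or there is an entry with the same
signature that is not larger; an entry that is larger is overwritten. -/
def insertCand : Prog :=
  scan ;; check ;;
  .ite (.and (.natLe (.const 1) (var cOk)) (.natLe (var cSgCount) (var cBound)))
    (search ;;
    .ite (.natLe (var cTop) (var cPos))
      (store ;; assign cTop (.add (var cTop) (.const 1)))
      (.ite (.natLe (.add (var cCount) (.const 1)) (.get cSize (var cPos))) store .skip))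
    .skip

/-- The result of inserting `D` into the list from position `hi`. -/
structure Inserted (P : Instance) (i j m hi : ℕ) (D : Finset ℕ) (s s' : State) : Prop where
  frame : Frame [cW, cCount, cSg, cSgCount, cX, cD, cBit, cOk, cR, cF, cPos, cQ, cMask, cSig, cSize,
    cTop, cV] s s'
  mask_eq : ∀ e < hi, s'.nat cMask e = s.nat cMask e
  le_top : hi ≤ s'.nat cTop 0
  segment : Segment P i j m s' hi (s'.nat cTop 0)
  mono : ∀ g c, Represented s hi (s.nat cTop 0) g c → Represented s' hi (s'.nat cTop 0) g c
  represented : P.Candidate i j m D →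
    Represented s' hi (s'.nat cTop 0) (mask (window P.X m D)) D.card

lemma Inserted.of_append {P : Instance} {i j m hi : ℕ} {D : Finset ℕ} {s s' : State}
    (hf : Frame [cW, cCount, cSg, cSgCount, cX, cD, cBit, cOk, cR, cF, cPos, cQ, cMask, cSig, cSize,
      cTop, cV] s s') (hle : hi ≤ s.nat cTop 0) (hseg : Segment P i j m s hi (s.nat cTop 0))
    (hcand : P.Candidate i j m D) (htop : s'.nat cTop 0 = s.nat cTop 0 + 1)
    (hM : s'.nat cMask = Function.update (s.nat cMask) (s.nat cTop 0) (mask D))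
    (hS : s'.nat cSig = Function.update (s.nat cSig) (s.nat cTop 0) (mask (window P.X m D)))
    (hC : s'.nat cSize = Function.update (s.nat cSize) (s.nat cTop 0) D.card)
    (hne : ∀ e, hi ≤ e → e < s.nat cTop 0 → s.nat cSig e ≠ mask (window P.X m D)) :
    Inserted P i j m hi D s s' where
  frame := hf
  mask_eq e he := by rw [hM, Function.update_of_ne (by omega)]
  le_top := by omega
  segment := by
    constructor
    · intro e he1 he2
      rw [hM, hS, hC]
      rcases (show e ≤ s.nat cTop 0 by omega).eq_or_lt with rfl | h
      · exact ⟨D, hcand, by simp⟩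
      · simp only [Function.update_of_ne h.ne]
        exact hseg.entry e he1 h
    · intro e e' he1 he2 he1' he2' hee
      rw [hS] at hee
      rcases (show e ≤ s.nat cTop 0 by omega).eq_or_lt with rfl | h <;>
        rcases (show e' ≤ s.nat cTop 0 by omega).eq_or_lt with h' | h'
      · exact h'.symm
      · rw [Function.update_self, Function.update_of_ne h'.ne] at hee
        exact absurd hee.symm (hne _ he1' h')
      · rw [h', Function.update_self, Function.update_of_ne h.ne] at hee
        exact absurd hee (hne _ he1 h)
      · rw [Function.update_of_ne h.ne, Function.update_of_ne h'.ne] at hee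
        exact hseg.inj _ _ he1 h he1' h' hee
  mono := by
    rintro g c ⟨e, he1, he2, h1, h2⟩
    refine ⟨e, he1, by omega, ?_, ?_⟩
    · rwa [hS, Function.update_of_ne he2.ne]
    · rwa [hC, Function.update_of_ne he2.ne]
  represented _ := ⟨s.nat cTop 0, hle, by omega, by rw [hS]; simp, by rw [hC]; simp⟩

/-- Overwriting a larger entry of the same signature changes no signature and only lowers a size, so
everything represented before remains so. -/
lemma Inserted.of_replace {P : Instance} {i j m hi pos : ℕ} {D : Finset ℕ} {s s' : State}
    (hf : Frame [cW, cCount, cSg, cSgCount, cX, cD, cBit, cOk, cR, cF, cPos, cQ, cMask, cSig, cSize,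
      cTop, cV] s s') (hle : hi ≤ s.nat cTop 0) (hseg : Segment P i j m s hi (s.nat cTop 0))
    (hcand : P.Candidate i j m D) (htop : s'.nat cTop 0 = s.nat cTop 0)
    (hM : s'.nat cMask = Function.update (s.nat cMask) pos (mask D))
    (hS : s'.nat cSig = Function.update (s.nat cSig) pos (mask (window P.X m D)))
    (hC : s'.nat cSize = Function.update (s.nat cSize) pos D.card)
    (hpos₁ : hi ≤ pos) (hpos₂ : pos < s.nat cTop 0)
    (hsig : s.nat cSig pos = mask (window P.X m D)) (hlt : D.card < s.nat cSize pos) :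
    Inserted P i j m hi D s s' := by
  rw [← hsig, Function.update_eq_self] at hS
  refine ⟨hf, fun e he => by rw [hM, Function.update_of_ne (by omega)], by omega, ⟨?_, ?_⟩, ?_, ?_⟩
  · intro e he1 he2
    rw [hM, hS, hC]
    rcases eq_or_ne e pos with rfl | h
    · exact ⟨D, hcand, by simp [hsig]⟩
    · simp only [Function.update_of_ne h]
      exact hseg.entry e he1 (by omega)
  · rw [hS, htop]; exact hseg.inj
  · rintro g c ⟨e, he1, he2, h1, h2⟩
    refine ⟨e, he1, by omega, by rwa [hS], ?_⟩
    rw [hC]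
    rcases eq_or_ne e pos with rfl | h
    · rw [Function.update_self]; omega
    · rwa [Function.update_of_ne h]
  · exact fun _ => ⟨pos, hpos₁, by omega, by rw [hS, hsig], by rw [hC]; simp⟩

lemma Inserted.of_unchanged {P : Instance} {i j m hi : ℕ} {D : Finset ℕ} {s s' : State} {l : List ℕ}
    (hf : Frame l s s') (hle : hi ≤ s.nat cTop 0) (hseg : Segment P i j m s hi (s.nat cTop 0))
    (hD : P.Candidate i j m D → Represented s hi (s.nat cTop 0) (mask (window P.X m D)) D.card)
    (hl : l ⊆ [cW, cCount, cSg, cSgCount, cX, cD, cBit, cOk, cR, cF, cPos, cQ] := by decide) :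
    Inserted P i j m hi D s s' := by
  have hf' : Frame [cW, cCount, cSg, cSgCount, cX, cD, cBit, cOk, cR, cF, cPos, cQ] s s' :=
    (Frame.refl l s).trans hf hl hl
  have hM : s'.nat cMask = s.nat cMask := hf'.nat _ (by decide)
  have hS : s'.nat cSig = s.nat cSig := hf'.nat _ (by decide)
  have hC : s'.nat cSize = s.nat cSize := hf'.nat _ (by decide)
  have hT : s'.nat cTop = s.nat cTop := hf'.nat _ (by decide)
  have hR : Represented s' = Represented s := by
    funext lo hi g c; simp only [Represented, hS, hC]
  refine ⟨(Frame.refl _ s).trans hf' (by decide : [] ⊆ _) (by decide), fun e _ => by rw [hM],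
    by rwa [hT], ⟨?_, ?_⟩, ?_, ?_⟩
  · rw [hM, hS, hC, hT]; exact hseg.entry
  · rw [hS, hT]; exact hseg.inj
  · rw [hT, hR]; exact fun _ _ => id
  · rw [hT, hR]; exact hD

/-- The quadratic term pays for `scan` and `check`, the power for `search` through a list whose
length `Segment.sub_le` bounds. -/
lemma insertCand_spec {P : Instance} {s : State} {i j m hi : ℕ} {D : Finset ℕ} (hs : Stores P s)
    (hi' : s.nat cI 0 = i) (hj : s.nat cJ 0 = j) (hm : s.nat cM 0 = m) (hmn : m < P.n)
    (hD : D ⊆ range (m + 1)) (hv : s.nat cV 0 = mask D) (hhi : s.nat cHi 0 = hi)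
    (hle : hi ≤ s.nat cTop 0) (hseg : Segment P i j m s hi (s.nat cTop 0)) :
    Reaches insertCand s (500 * ((P.n + 1) ^ 2 + (P.n + 1) ^ P.B)) (Inserted P i j m hi D s) := by
  classical
  have hDn : D ⊆ range P.n := hD.trans (range_subset_range.2 (by omega))
  apply Reaches.of_le
  rotate_left
  · apply Reaches.seq
    refine (scan_spec hs.n hs.pow hDn hv).imp ?_
    rintro s₁ ⟨hf₁, hb, hcount, hsg, hsgc⟩
    have hs₁ := hs.frame hf₁
    rw [hm, hs.X] at hsg hsgc
    apply Reaches.seq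
    refine (check_spec (i := i) (j := j) (m := m) hs₁ (by rw [hf₁.nat _ (by decide), hi'])
      (by rw [hf₁.nat _ (by decide), hj]) (by rw [hf₁.nat _ (by decide), hm]) hDn hb).imp ?_
    rintro s₂ ⟨hf₂, hok⟩
    have hs₂ := hs₁.frame hf₂
    have hf : Frame [cW, cCount, cSg, cSgCount, cX, cD, cBit, cOk, cR, cF] s s₂ :=
      hf₁.trans hf₂ (by decide) (by decide)
    rw [← hf₂.nat cCount (by decide)] at hcount
    rw [← hf₂.nat cSg (by decide)] at hsg
    rw [← hf₂.nat cSgCount (by decide)] at hsgc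
    have htop₂ : s₂.nat cTop 0 = s.nat cTop 0 := by rw [hf.nat _ (by decide)]
    have hhi₂ : s₂.nat cHi 0 = hi := by rw [hf.nat _ (by decide), hhi]
    have hv₂ : s₂.nat cV 0 = mask D := by rw [hf.nat _ (by decide), hv]
    have hmask₂ : s₂.nat cMask = s.nat cMask := hf.nat _ (by decide)
    have hsig₂ : s₂.nat cSig = s.nat cSig := hf.nat _ (by decide)
    have hsize₂ : s₂.nat cSize = s.nat cSize := hf.nat _ (by decide)
    apply Reaches.ite
    · intro hc
      simp [hok, hsgc, hs₂.bound] at hc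
      have hcov : P.Covers i j m D := by by_contra h; simp [h] at hc
      have hcand : P.Candidate i j m D := ⟨hD, hcov, hc.2⟩
      apply Reaches.seq
      refine Reaches.mono (search_spec hhi₂ htop₂ hle)
        (T' := 60 * (P.n + 1) ^ P.B + 60) ?_ ?_
      · have := hseg.sub_le hmn
        omega
      · rintro s₃ ⟨hf₃, hpos⟩
        rw [← hf₃.nat cCount (by decide)] at hcount
        rw [hsg, hsig₂] at hpos
        rw [← hf₃.nat cSg (by decide)] at hsg
        rw [← hf₃.nat cTop (by decide)] at htop₂
        rw [← hf₃.nat cV (by decide)] at hv₂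
        rw [← hf₃.nat cMask (by decide)] at hmask₂
        rw [← hf₃.nat cSig (by decide)] at hsig₂
        rw [← hf₃.nat cSize (by decide)] at hsize₂
        have hf' : Frame [cW, cCount, cSg, cSgCount, cX, cD, cBit, cOk, cR, cF, cPos, cQ] s s₃ :=
          hf.trans hf₃ (by decide) (by decide)
        clear hf₁ hf₂ hf₃ hs₁ hs₂ hb hok hsgc hf hhi₂
        apply Reaches.ite
        · intro hc1
          simp [htop₂] at hc1
          have hpos' : s₃.nat cPos 0 = s.nat cTop 0 ∧
              ∀ e, hi ≤ e → e < s.nat cTop 0 → s.nat cSig e ≠ mask (window P.X m D) :=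
            hpos.resolve_right fun h => by omega
          obtain ⟨hpos1, hpos2⟩ := hpos'
          apply Reaches.seq
          apply Reaches.seq
          apply Reaches.setNat
          apply Reaches.seq
          apply Reaches.setNat
          apply Reaches.setNat
          apply Reaches.setNat
          refine Inserted.of_append ?_ hle hseg hcand (by simp [htop₂])
            (by simp [hpos1, hmask₂, hv₂]) (by simp [hpos1, hsig₂, hsg])
            (by simp [hpos1, hsize₂, hcount]) hpos2
          iterate 4 refine Frame.setNat ?_ (by simp) _ _
          exact (Frame.refl [] s).trans hf' (by decide) (by decide)
        · intro hc1
          simp [htop₂] at hc1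
          obtain ⟨hpos1, hpos2, hpos3⟩ := hpos.resolve_left fun h => by omega
          apply Reaches.ite
          · intro hc2
            simp [hcount, hsize₂] at hc2
            apply Reaches.seq
            apply Reaches.setNat
            apply Reaches.seq
            apply Reaches.setNat
            apply Reaches.setNat
            refine Inserted.of_replace (pos := s₃.nat cPos 0) ?_ hle hseg hcand (by simp [htop₂])
              (by simp [hmask₂, hv₂]) (by simp [hsig₂, hsg]) (by simp [hsize₂, hcount]) hpos1 hpos2
              hpos3 (by omega)
            iterate 3 refine Frame.setNat ?_ (by simp) _ _
            exact (Frame.refl [] s).trans hf' (by decide) (by decide)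
          · intro hc2
            simp [hcount, hsize₂] at hc2
            apply Reaches.skip
            exact Inserted.of_unchanged hf' hle hseg fun _ => ⟨_, hpos1, hpos2, hpos3, by omega⟩
    · intro hc
      simp [hok, hsgc, hs₂.bound, -not_and, -not_le] at hc
      apply Reaches.skip
      exact Inserted.of_unchanged hf hle hseg fun h =>
        absurd ⟨by simp [h.covers], h.card_window_le⟩ hc
  · simp
    have h1 : 1 ≤ (P.n + 1) ^ P.B := Nat.one_le_pow _ _ (by omega)
    have h2 : P.n + 1 ≤ (P.n + 1) ^ 2 := Nat.le_self_pow two_ne_zero _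
    linarith

lemma Segment.congr {P : Instance} {i j m : ℕ} {s s' : State} {lo hi : ℕ}
    (h : Segment P i j m s lo hi) (hM : s'.nat cMask = s.nat cMask) (hS : s'.nat cSig = s.nat cSig)
    (hC : s'.nat cSize = s.nat cSize) : Segment P i j m s' lo hi :=
  ⟨by rw [hM, hS, hC]; exact h.entry, by rw [hS]; exact h.inj⟩

lemma Represented.congr {s s' : State} {lo hi g c : ℕ} (h : Represented s lo hi g c)
    (hS : s'.nat cSig = s.nat cSig) (hC : s'.nat cSize = s.nat cSize) :
    Represented s' lo hi g c := by
  rw [Represented, hS, hC]; exact h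

/-- Add the set with bit mask `e` to the list. -/
def extend (e : NExp) : Prog := assign cV e ;; insertCand

lemma extend_spec {P : Instance} {s : State} {i j m hi : ℕ} {D : Finset ℕ} {e : NExp}
    (hs : Stores P s) (hi' : s.nat cI 0 = i) (hj : s.nat cJ 0 = j) (hm : s.nat cM 0 = m)
    (hmn : m < P.n) (hD : D ⊆ range (m + 1)) (hv : e.eval s = mask D) (hhi : s.nat cHi 0 = hi)
    (hle : hi ≤ s.nat cTop 0) (hseg : Segment P i j m s hi (s.nat cTop 0)) :
    Reaches (extend e) s (e.cost + 2 + 500 * ((P.n + 1) ^ 2 + (P.n + 1) ^ P.B))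
      (Inserted P i j m hi D s) := by
  apply Reaches.of_le
  rotate_left
  · apply Reaches.seq
    apply Reaches.setNat
    have hf : Frame [cV] s (s.setNat cV ((NExp.const 0).eval s) (e.eval s)) :=
      (Frame.refl _ s).setNat (by simp) _ _
    refine (insertCand_spec (hi := hi) (i := i) (j := j) (D := D) (hs.frame hf) (by simp [hi'])
      (by simp [hj]) (by simp [hm]) hmn hD (by simp [hv]) (by simp [hhi]) (by simpa using hle)
      ?_).imp ?_
    · simp only [hf.nat cTop (by decide)]
      exact hseg.congr (by simp) (by simp) (by simp)
    · intro s' h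
      exact
        { frame := hf.trans h.frame (by decide) (by decide)
          mask_eq := fun x hx => by rw [h.mask_eq x hx, hf.nat _ (by decide)]
          le_top := h.le_top
          segment := h.segment
          mono := fun g c hg => h.mono g c (by
            rw [hf.nat _ (by decide)]
            exact hg.congr (hf.nat _ (by decide)) (hf.nat _ (by decide)))
          represented := h.represented }
  · simp
    omega

/-! ### The sweep within one strip -/

/-- Extend all entries of the list `cLo, …, cHi - 1` by the two decisions about point `cM`. -/
def sweepStep : Prog :=
  assign cTop (var cHi) ;;
  forTo cE (var cLo) (var cHi)
    (extend (.get cMask (var cE)) ;;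
    extend (.add (.get cMask (var cE)) (.get cPow (var cM)))) ;;
  assign cLo (var cHi) ;; assign cHi (var cTop)

/-- List candidates for dominating the points with rank in `[cI, cJ)`. -/
def sweep : Prog :=
  assign cLo (.const 0) ;; assign cHi (.const 1) ;; .setNat cMask (.const 0) (.const 0) ;;
  forTo cM (.const 0) (var 0) sweepStep

/-- The points are sorted by abscissa, and there is a sentinel to the right of them. -/
structure Instance.Sorted (P : Instance) : Prop where
  mono : ∀ a b, a ≤ b → b ≤ P.n → P.X a ≤ P.X b
  sentinel : ∀ r < P.n, P.X r + 2 ≤ P.X P.n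

/-- `D` dominates the points with rank in `[i, j)`, and its windows are small. -/
abbrev Instance.Thin (P : Instance) (i j : ℕ) (D : Finset ℕ) : Prop :=
  IsThinDominating P.n P.X P.Y P.R P.B i j D

/-- The list `cLo, …, cHi - 1` of partial solutions before point `m` is considered. -/
structure Level (P : Instance) (i j m : ℕ) (s : State) : Prop where
  le : s.nat cLo 0 ≤ s.nat cHi 0
  length_le : s.nat cHi 0 - s.nat cLo 0 ≤ (P.n + 1) ^ P.B
  entry : ∀ e, s.nat cLo 0 ≤ e → e < s.nat cHi 0 →
    ∃ D ⊆ range m, P.Covers i j (m - 1) D ∧ s.nat cMask e = mask D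
  complete : ∀ E, P.Thin i j E → ∃ e, s.nat cLo 0 ≤ e ∧ e < s.nat cHi 0 ∧ ∃ D,
    s.nat cMask e = mask D ∧ D.card ≤ (E.filter (· < m)).card ∧
      window P.X (m - 1) D = window P.X (m - 1) (E.filter (· < m))

/-- The window at `m` is cut out of the window at `m - 1`, because abscissae do not decrease. -/
lemma Instance.Sorted.window_congr {P : Instance} (hP : P.Sorted) {m : ℕ} (hm : m ≤ P.n)
    {D E : Finset ℕ} (h : window P.X (m - 1) D = window P.X (m - 1) E) :
    window P.X m D = window P.X m E := by
  have key : ∀ F, window P.X m F = (window P.X (m - 1) F).filter fun d => P.X m - 2 ≤ P.X d := by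
    intro F
    have := hP.mono (m - 1) m (Nat.sub_le _ _) hm
    simp only [window, filter_filter]
    refine filter_congr fun d _ => ⟨fun h => ⟨by linarith, h⟩, fun h => h.2⟩
  rw [key, key, h]

/-- This is why the window is all that must be remembered. A point `r` that has to be covered at `m`
but not yet at `m - 1` satisfies `X (m - 1) ≤ X r + 1 < X m`. Its dominator in `E` therefore has
index below `m` and abscissa at least `X (m - 1) - 2`, so it lies in the window that `D` shares with
`E`. -/
lemma Instance.Sorted.covers_next {P : Instance} (hP : P.Sorted) {i j m : ℕ}
    {D E : Finset ℕ} (hD : P.Covers i j (m - 1) D) (hE : P.Thin i j E)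
    (h : window P.X (m - 1) D = window P.X (m - 1) (E.filter (· < m))) : P.Covers i j m D := by
  intro r hr hir hrj hrm
  by_cases hlt : P.X r + 1 < P.X (m - 1)
  · exact hD r hr hir hrj hlt
  · obtain ⟨d, hd, hdr⟩ := hE.dominates r hr hir hrj
    have h1 := abs_le.1 hdr.abs_fst
    have hdm : d < m := by
      by_contra! hmd
      have := hP.mono m d hmd (mem_range.1 (hE.subset hd)).le
      linarith [h1.2]
    have h2 : d ∈ window P.X (m - 1) (E.filter (· < m)) := by
      simp only [window, mem_filter]
      exact ⟨⟨hd, hdm⟩, by linarith [h1.1]⟩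
    rw [← h] at h2
    exact ⟨d, (mem_filter.1 h2).1, hdr⟩

lemma Instance.Covers.mono {P : Instance} {i j m : ℕ} {D D' : Finset ℕ} (h : P.Covers i j m D)
    (hD : D ⊆ D') : P.Covers i j m D' := fun r hr hi hj hm => by
  obtain ⟨d, hd, hdr⟩ := h r hr hi hj hm
  exact ⟨d, hD hd, hdr⟩

/-- Follow the decision of `E` about `m`. Agreement of windows and the comparison of sizes both
survive, so `D'` can replace the part of `E` seen so far. -/
lemma Instance.Sorted.candidate_next {P : Instance} (hP : P.Sorted) {i j m : ℕ} (hm : m < P.n)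
    {D E : Finset ℕ} (hDm : D ⊆ range m) (hD : P.Covers i j (m - 1) D) (hE : P.Thin i j E)
    (hcard : D.card ≤ (E.filter (· < m)).card)
    (h : window P.X (m - 1) D = window P.X (m - 1) (E.filter (· < m))) :
    ∃ D', (D' = D ∨ D' = insert m D) ∧ P.Candidate i j m D' ∧
      D'.card ≤ (E.filter (· < m + 1)).card ∧
      window P.X m D' = window P.X m (E.filter (· < m + 1)) := by
  have hcov := hP.covers_next hD hE h
  have hwin := hP.window_congr hm.le h
  have hsucc : D ⊆ range (m + 1) := hDm.trans (range_subset_range.2 (by omega))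
  have hw := hE.card_window_le m hm
  simp only [Nat.lt_add_one_iff] at hw ⊢
  by_cases hmE : m ∈ E
  · have hw' : window P.X m (insert m D) = window P.X m (E.filter (· ≤ m)) := by
      rw [filter_le_eq_insert hmE, window_insert, window_insert, hwin]
    refine ⟨insert m D, Or.inr rfl, ⟨?_, hcov.mono (subset_insert _ _), by rwa [hw']⟩, ?_, hw'⟩
    · exact insert_subset (by simp) hsucc
    · rw [filter_le_eq_insert hmE, card_insert_of_notMem (s := E.filter (· < m)) (by simp)]
      exact (card_insert_le _ _).trans (by omega)
  · rw [filter_le_eq_lt hmE] at hw ⊢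
    exact ⟨D, Or.inl rfl, ⟨hsucc, hcov, by rwa [hwin]⟩, hcard, hwin⟩

lemma sweepStep_spec {P : Instance} (hP : P.Sorted) {s : State} {i j m : ℕ} (hs : Stores P s)
    (hi : s.nat cI 0 = i) (hj : s.nat cJ 0 = j) (hm : s.nat cM 0 = m) (hmn : m < P.n)
    (hlev : Level P i j m s) :
    Reaches sweepStep s
      (1200 * ((P.n + 1) ^ P.B * ((P.n + 1) ^ 2 + (P.n + 1) ^ P.B))) fun s' =>
      Frame stepVars s s' ∧ Level P i j (m + 1) s' := by
  set lo := s.nat cLo 0 with hlo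
  set hi₀ := s.nat cHi 0 with hhi₀
  have hseg0 : ∀ st, Segment P i j m st hi₀ hi₀ := fun st =>
    ⟨fun e h1 h2 => by omega, fun e _ h1 h2 => by omega⟩
  -- The new level is written from `hi₀` on, so the old level stays readable below `hi₀`. The last
  -- clause says that, for the entries already treated, each of the two extensions that is a
  -- candidate is represented.
  let I : ℕ → State → Prop := fun x st =>
    Frame [18, 19, 20, 21, 22, 23, 24, 25, 26, 27, 28, 29, 30, 31, 9, 10, 11, 12] s st ∧
    (∀ e < hi₀, st.nat cMask e = s.nat cMask e) ∧ hi₀ ≤ st.nat cTop 0 ∧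
    Segment P i j m st hi₀ (st.nat cTop 0) ∧
    ∀ e, lo ≤ e → e < x → ∀ D D', s.nat cMask e = mask D → (D' = D ∨ D' = insert m D) →
      P.Candidate i j m D' → Represented st hi₀ (st.nat cTop 0) (mask (window P.X m D')) D'.card
  apply Reaches.of_le
  rotate_left
  · apply Reaches.seq
    apply Reaches.setNat
    apply Reaches.seq
    refine Reaches.forTo I (A := lo) (by simp [hlo]) hlev.le ?_ ?_
      (T := 1000 * ((P.n + 1) ^ 2 + (P.n + 1) ^ P.B) + 40) ?_ ?_
    · refine ⟨?_, by simp, by simp [hhi₀], ?_, fun e h1 h2 => by omega⟩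
      · iterate 2 refine Frame.setNat ?_ (by simp) _ _
        exact Frame.refl _ _
      · simp [← hhi₀]; exact hseg0 _
    · rintro x st ⟨hf, -⟩
      simp [hf.nat]
    · rintro x st hx1 hx2 hcx ⟨hf, hmask, hle, hseg, hrep⟩
      have hst := hs.frame hf
      obtain ⟨D, hDm, hDc, hDmask⟩ := hlev.entry x hx1 hx2
      have hmD : m ∉ D := fun h => by simpa using hDm h
      apply Reaches.of_le
      rotate_left
      · apply Reaches.seq
        refine (extend_spec (i := i) (j := j) (m := m) (hi := hi₀) (D := D) hst
          (by rw [hf.nat _ (by decide), hi]) (by rw [hf.nat _ (by decide), hj])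
          (by rw [hf.nat _ (by decide), hm]) hmn (hDm.trans (range_subset_range.2 (by omega)))
          (by simp [hcx, hmask x hx2, hDmask]) (by rw [hf.nat _ (by decide)]) hle hseg).imp ?_
        intro s₁ h₁
        have hf₁ : Frame [18, 19, 20, 21, 22, 23, 24, 25, 26, 27, 28, 29, 30, 31, 9, 10, 11, 12] s
          s₁ := hf.trans h₁.frame (by decide) (by decide)
        have hs₁ := hst.frame h₁.frame
        refine (extend_spec (i := i) (j := j) (m := m) (hi := hi₀) (D := insert m D) hs₁
          (by rw [hf₁.nat _ (by decide), hi]) (by rw [hf₁.nat _ (by decide), hj])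
          (by rw [hf₁.nat _ (by decide), hm]) hmn
          (insert_subset (by simp) (hDm.trans (range_subset_range.2 (by omega)))) ?_
          (by rw [hf₁.nat _ (by decide)]) h₁.le_top h₁.segment).imp ?_
        · rw [mask_insert hmD]
          simp [h₁.frame.nat cE (by decide), hcx, h₁.mask_eq x hx2, hmask x hx2, hDmask,
            hf₁.nat cM (by decide), hm, hs₁.pow m hmn.le]
        intro s₂ h₂
        have hf₂ := hf₁.trans h₂.frame (l := [18, 19, 20, 21, 22, 23, 24, 25, 26, 27, 28, 29, 30, 31,
          9, 10, 11, 12]) (by decide) (by decide)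
        refine ⟨?_, hf₂.setNat (by simp) _ _, fun e he => ?_, ?_, ?_, ?_⟩
        · rw [h₂.frame.nat _ (by decide), h₁.frame.nat _ (by decide), hcx]
        · rw [State.setNat_nat_of_ne _ _ _ (by decide), h₂.mask_eq e he, h₁.mask_eq e he, hmask e he]
        · rw [State.setNat_nat_of_ne _ _ _ (by decide)]; exact h₂.le_top
        · rw [State.setNat_nat_of_ne _ _ _ (by decide)]
          exact h₂.segment.congr (by simp) (by simp) (by simp)
        · intro e he1 he2 D₁ D₂ hD₁ hD₂ hcand
          rw [State.setNat_nat_of_ne _ _ _ (by decide)]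
          refine Represented.congr (s := s₂) ?_ (by simp) (by simp)
          rcases (Nat.lt_succ_iff.1 he2).lt_or_eq with h7 | rfl
          · exact h₂.mono _ _ (h₁.mono _ _ (hrep e he1 h7 D₁ D₂ hD₁ hD₂ hcand))
          · obtain rfl := mask_injective (hD₁.symm.trans hDmask)
            rcases hD₂ with rfl | rfl
            · exact h₂.mono _ _ (h₁.represented hcand)
            · exact h₂.represented hcand
      · simp
        omega
    · rintro st - ⟨hf, hmask, hle, hseg, hrep⟩
      have hhi' : st.nat cHi 0 = hi₀ := by rw [hf.nat _ (by decide)]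
      apply Reaches.seq
      apply Reaches.setNat
      apply Reaches.setNat
      refine ⟨?_, ?_, ?_, ?_, ?_⟩
      · iterate 2 refine Frame.setNat ?_ (by simp) _ _
        exact (Frame.refl [] s).trans hf (by decide) (by decide)
      · simpa [hhi'] using hle
      · simpa [hhi'] using hseg.sub_le hmn
      · simp [hhi']
        intro e he1 he2
        obtain ⟨D, hD, h1, -⟩ := hseg.entry e he1 he2
        exact ⟨D, hD.subset, hD.covers, h1⟩
      · simp only [State.setNat_nat_self]
        simp [hhi']
        intro E hE
        obtain ⟨e, he1, he2, D, h1, h2, h3⟩ := hlev.complete E hE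
        obtain ⟨D₀, h4, h5, h6⟩ := hlev.entry e he1 he2
        obtain rfl := mask_injective (h1.symm.trans h6)
        -- The extension `D'` that follows `E` need not be listed itself. The entry `D''` with its
        -- signature is no larger and, masks being injective, has the same window.
        obtain ⟨D', h7, h8, h9, h10⟩ := hP.candidate_next hmn h4 h5 hE h2 h3
        obtain ⟨e', he1', he2', h11, h12⟩ := hrep e he1 he2 D D' h1 h7 h8
        obtain ⟨D'', h13, h14, h15, h16⟩ := hseg.entry e' he1' he2'
        have h17 := mask_injective (h15.symm.trans h11)
        simp only [Nat.lt_add_one_iff] at h9 h10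
        exact ⟨e', he1', he2', D'', h14, by omega, h17.trans h10⟩
  · simp
    have h1 : 1 ≤ (P.n + 1) ^ P.B := Nat.one_le_pow _ _ (by omega)
    have h2 : 1 ≤ (P.n + 1) ^ 2 := Nat.one_le_pow _ _ (by omega)
    have h3 := hlev.length_le
    rw [← hlo] at h3
    generalize (P.n + 1) ^ P.B = N at *
    generalize (P.n + 1) ^ 2 = G at *
    have h4 : N * 2 ≤ N * (G + N) := Nat.mul_le_mul_left _ (by omega)
    have h5 := Nat.mul_le_mul_right (1000 * (G + N) + 40 + 2 + 12) h3
    have h6 : N * (1000 * (G + N) + 40 + 2 + 12) = 1000 * (N * (G + N)) + 54 * N := by ring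
    generalize N * (G + N) = Z at *
    omega

lemma sweep_spec {P : Instance} (hP : P.Sorted) {s : State} {i j : ℕ} (hs : Stores P s)
    (hi : s.nat cI 0 = i) (hj : s.nat cJ 0 = j) :
    Reaches sweep s
      (1300 * ((P.n + 1) * ((P.n + 1) ^ P.B * ((P.n + 1) ^ 2 + (P.n + 1) ^ P.B)))) fun s' =>
      Frame (cM :: stepVars) s s' ∧ Level P i j P.n s' ∧ s'.nat cM 0 = P.n := by
  apply Reaches.of_le
  rotate_left
  · iterate 3
      apply Reaches.seq
      apply Reaches.setNat
    refine Reaches.forTo (fun x s' => Frame (cM :: stepVars) s s' ∧ Level P i j x s') rfl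
      (Nat.zero_le P.n) ?_ ?_
      (T := 1200 * ((P.n + 1) ^ P.B * ((P.n + 1) ^ 2 + (P.n + 1) ^ P.B))) ?_ ?_
    · refine ⟨?_, by simp, ?_, ?_, ?_⟩
      · iterate 4 refine Frame.setNat ?_ (by simp) _ _
        exact Frame.refl _ _
      · simpa using Nat.one_le_pow P.B (P.n + 1) (by omega)
      -- Here `m - 1` truncates to 0, and no point is more than 1 to the left of point 0.
      · simp
        intro r hr _ _ h
        have := hP.mono 0 r (by omega) hr.le
        linarith
      -- The initial list contains only the empty set, which matches the empty initial part of any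
      -- `E`.
      · intro E _
        exact ⟨0, by simp, by simp, ∅, by simp, by simp, by simp [window]⟩
    · rintro x st ⟨hf, -⟩
      simp [(hs.frame hf).n]
    · rintro x st - hx hcx ⟨hf, hlev⟩
      refine (sweepStep_spec hP (hs.frame hf) (by rw [hf.nat _ (by decide), hi])
        (by rw [hf.nat _ (by decide), hj]) hcx hx hlev).imp ?_
      rintro s₁ ⟨hf₁, hlev₁⟩
      refine ⟨by rw [hf₁.nat _ (by decide), hcx], ?_, ?_⟩
      · exact (hf.trans hf₁ (l := cM :: stepVars) (by decide) (by decide)).setNat (by simp) _ _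
      · exact ⟨by simpa using hlev₁.le, by simpa using hlev₁.length_le,
          by simpa using hlev₁.entry, by simpa using hlev₁.complete⟩
    · rintro st hM ⟨hf, hlev⟩
      exact ⟨hf, hlev, hM⟩
  · simp
    have h1 : 1 ≤ (P.n + 1) ^ P.B := Nat.one_le_pow _ _ (by omega)
    have h2 : 1 ≤ (P.n + 1) ^ 2 := Nat.one_le_pow _ _ (by omega)
    generalize (P.n + 1) ^ P.B = N at *
    generalize (P.n + 1) ^ 2 = G at *
    have h3 : 1 * 2 ≤ N * (G + N) := Nat.mul_le_mul h1 (by omega)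
    generalize N * (G + N) = Z at *
    nlinarith

/-! ### The dynamic program over the ranks -/

/-- Use the set at position `cE` of the list for the strip of ranks `[cI, cJ)` if that improves the
solution for the ranks below `cJ`. -/
def relax : Prog :=
  assign cV (.get cMask (var cE)) ;; scan ;; check ;;
  .ite (.and (.natLe (.const 1) (var cOk))
      (.natLe (.add (.add (.get cVal (var cI)) (var cCount)) (.const 1)) (.get cVal (var cJ))))
    (.setNat cVal (var cJ) (.add (.get cVal (var cI)) (var cCount)) ;;
    .setNat cPrev (var cJ) (var cI) ;; .setNat cSol (var cJ) (var cV))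
    .skip

/-- Improve the solution for the ranks below `cJ` by a solution for the strip `[cI, cJ)`. -/
def stripStep : Prog := sweep ;; forTo cE (var cLo) (var cHi) relax

/-- The dynamic program over the ranks. -/
def dp : Prog :=
  .setNat cVal (.const 0) (.const 0) ;;
  forTo cJ (.const 1) (.add (var 0) (.const 1))
    (.setNat cVal (var cJ) (var 0) ;; .setNat cPrev (var cJ) (.const 0) ;;
    .setNat cSol (var cJ) (.sub (.get cPow (var 0)) (.const 1)) ;;
    forTo cI (.const 0) (var cJ) stripStep)

/-- The table entry for the ranks below `j` consists of a solution for the ranks in `[i, j)` and the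
table entry for some `i < j`. -/
structure Row (P : Instance) (j : ℕ) (s : State) : Prop where
  lt : s.nat cPrev j < j
  sol : ∃ D ⊆ range P.n, s.nat cSol j = mask D ∧
    s.nat cVal j = s.nat cVal (s.nat cPrev j) + D.card ∧
    ∀ r < P.n, s.nat cPrev j ≤ P.R r → P.R r < j → Dominates P.X P.Y D r

lemma Row.congr {P : Instance} {j : ℕ} {s s' : State} (h : Row P j s)
    (hV : ∀ i ≤ j, s'.nat cVal i = s.nat cVal i) (hP : s'.nat cPrev j = s.nat cPrev j)
    (hS : s'.nat cSol j = s.nat cSol j) : Row P j s' := by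
  have := h.lt
  refine ⟨by omega, ?_⟩
  rw [hP, hS, hV _ le_rfl, hV _ this.le]
  exact h.sol

/-- The table entry for `j` in `s'` is valid and at least as good as that in `s`. -/
structure Improves (P : Instance) (j : ℕ) (s s' : State) : Prop where
  val_eq : ∀ i, i ≠ j → s'.nat cVal i = s.nat cVal i
  prev_eq : ∀ i, i ≠ j → s'.nat cPrev i = s.nat cPrev i
  sol_eq : ∀ i, i ≠ j → s'.nat cSol i = s.nat cSol i
  le : s'.nat cVal j ≤ s.nat cVal j
  row : Row P j s → Row P j s'

lemma Improves.trans {P : Instance} {j : ℕ} {s₁ s₂ s₃ : State} (h : Improves P j s₁ s₂)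
    (h' : Improves P j s₂ s₃) : Improves P j s₁ s₃ where
  val_eq i hi := (h'.val_eq i hi).trans (h.val_eq i hi)
  prev_eq i hi := (h'.prev_eq i hi).trans (h.prev_eq i hi)
  sol_eq i hi := (h'.sol_eq i hi).trans (h.sol_eq i hi)
  le := h'.le.trans h.le
  row h₁ := h'.row (h.row h₁)

lemma Improves.of_eq {P : Instance} {j : ℕ} {s s' : State} (hV : s'.nat cVal = s.nat cVal)
    (hP : s'.nat cPrev = s.nat cPrev) (hS : s'.nat cSol = s.nat cSol) : Improves P j s s' :=
  ⟨fun _ _ => by rw [hV], fun _ _ => by rw [hP], fun _ _ => by rw [hS], by rw [hV],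
    fun h => h.congr (fun _ _ => by rw [hV]) (by rw [hP]) (by rw [hS])⟩

/-- The sentinel exceeds every abscissa by at least 2, so at `P.n` the coverage condition exempts no
point. -/
lemma Instance.Sorted.dominates_of_covers {P : Instance} (hP : P.Sorted) {i j : ℕ} {D : Finset ℕ}
    (h : P.Covers i j P.n D) : ∀ r < P.n, i ≤ P.R r → P.R r < j → Dominates P.X P.Y D r :=
  fun r hr hi hj => h r hr hi hj (by linarith [hP.sentinel r hr])

lemma relax_spec {P : Instance} (hP : P.Sorted) {s : State} {i j : ℕ} {D : Finset ℕ}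
    (hs : Stores P s) (hi : s.nat cI 0 = i) (hj : s.nat cJ 0 = j) (hm : s.nat cM 0 = P.n)
    (hij : i < j) (hD : D ⊆ range P.n) (hv : s.nat cMask (s.nat cE 0) = mask D) :
    Reaches relax s (400 * (P.n + 1) ^ 2) fun s' => Frame relaxVars s s' ∧ Improves P j s s' ∧
      (P.Covers i j P.n D → s'.nat cVal j ≤ s.nat cVal i + D.card) := by
  classical
  apply Reaches.of_le
  rotate_left
  · apply Reaches.seq
    apply Reaches.setNat
    have hf₀ : Frame [cV] s (s.setNat cV ((NExp.const 0).eval s) (NExp.eval s (.get cMask (var cE)))) :=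
      (Frame.refl _ s).setNat (by simp) _ _
    apply Reaches.seq
    refine (scan_spec (hs.frame hf₀).n (hs.frame hf₀).pow hD (by simp [hv])).imp ?_
    rintro s₁ ⟨hf₁, hb, hcount, -, -⟩
    have hf₁' : Frame [cV, cW, cCount, cSg, cSgCount, cX, cD, cBit] s s₁ :=
      hf₀.trans hf₁ (by decide) (by decide)
    have hv₁ : s₁.nat cV 0 = mask D := by rw [hf₁.nat _ (by decide)]; simp [hv]
    have hs₁ := hs.frame hf₁'
    apply Reaches.seq
    refine (check_spec (i := i) (j := j) (m := P.n) hs₁ (by rw [hf₁'.nat _ (by decide), hi])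
      (by rw [hf₁'.nat _ (by decide), hj]) (by rw [hf₁'.nat _ (by decide), hm]) hD hb).imp ?_
    rintro s₂ ⟨hf₂, hok⟩
    rw [← hf₂.nat cCount (by decide)] at hcount
    rw [← hf₂.nat cV (by decide)] at hv₁
    have hf : Frame [cV, cW, cCount, cSg, cSgCount, cX, cD, cBit, cOk, cR, cF] s s₂ :=
      hf₁'.trans hf₂ (by decide) (by decide)
    have hi₂ : s₂.nat cI 0 = i := by rw [hf.nat _ (by decide), hi]
    have hj₂ : s₂.nat cJ 0 = j := by rw [hf.nat _ (by decide), hj]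
    have hV : s₂.nat cVal = s.nat cVal := hf.nat _ (by decide)
    have hR : s₂.nat cPrev = s.nat cPrev := hf.nat _ (by decide)
    have hS : s₂.nat cSol = s.nat cSol := hf.nat _ (by decide)
    apply Reaches.ite
    · intro hc
      simp [hok, hi₂, hj₂, hcount, hV] at hc
      have hcov : P.Covers i j P.n D := by by_contra h; simp [h] at hc
      apply Reaches.seq
      apply Reaches.setNat
      apply Reaches.seq
      apply Reaches.setNat
      apply Reaches.setNat
      refine ⟨?_, ⟨?_, ?_, ?_, ?_, fun _ => ⟨?_, D, hD, ?_, ?_, ?_⟩⟩, fun _ => ?_⟩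
      · iterate 3 refine Frame.setNat ?_ (by simp) _ _
        exact (Frame.refl [] s).trans hf (by decide) (by decide)
      · intro i' hi'; simp [hj₂, hV, hi']
      · intro i' hi'; simp [hj₂, hR, hi']
      · intro i' hi'; simp [hj₂, hS, hi']
      · simp [hi₂, hj₂, hV, hcount]; omega
      · simpa [hi₂, hj₂] using hij
      · simp [hj₂, hv₁]
      · simp [hi₂, hj₂, hV, hcount, hij.ne]
      · simpa [hi₂, hj₂] using hP.dominates_of_covers hcov
      · simp [hi₂, hj₂, hV, hcount]
    · intro hc
      simp [hok, hi₂, hj₂, hcount, hV, -not_and, -not_le] at hc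
      apply Reaches.skip
      refine ⟨(Frame.refl [] s).trans hf (by decide) (by decide), Improves.of_eq hV hR hS,
        fun h => ?_⟩
      rw [hV]
      by_contra h'
      exact hc ⟨by simp [h], by omega⟩
  · simp
    nlinarith

/-- The value is compared only with thin sets `E`, and only from above. That it belongs to an actual
solution is the content of `Row`, which `Improves` preserves. -/
lemma stripStep_spec {P : Instance} (hP : P.Sorted) {s : State} {i j : ℕ} (hs : Stores P s)
    (hi : s.nat cI 0 = i) (hj : s.nat cJ 0 = j) (hij : i < j) :
    Reaches stripStep s
      (2000 * ((P.n + 1) * ((P.n + 1) ^ P.B * ((P.n + 1) ^ 2 + (P.n + 1) ^ P.B)))) fun s' =>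
      Frame (cVal :: cPrev :: cSol :: cM :: stepVars) s s' ∧ Improves P j s s' ∧
      ∀ E, P.Thin i j E → s'.nat cVal j ≤ s.nat cVal i + E.card := by
  apply Reaches.of_le
  rotate_left
  · apply Reaches.seq
    refine Reaches.mono (sweep_spec hP hs hi hj) le_rfl ?_
    rintro s₁ ⟨hf₁, hlev, hm⟩
    have hs₁ := hs.frame hf₁
    have hV : s₁.nat cVal = s.nat cVal := hf₁.nat _ (by decide)
    have hR : s₁.nat cPrev = s.nat cPrev := hf₁.nat _ (by decide)
    have hS : s₁.nat cSol = s.nat cSol := hf₁.nat _ (by decide)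
    refine Reaches.of_le ?_ (Reaches.forTo (fun x st => Frame (cE :: relaxVars) s₁ st ∧
      Improves P j s₁ st ∧ ∀ e D, s₁.nat cLo 0 ≤ e → e < x → s₁.nat cMask e = mask D →
        P.Covers i j P.n D → st.nat cVal j ≤ s₁.nat cVal i + D.card) rfl hlev.le ?_ ?_
        (T := 400 * (P.n + 1) ^ 2) ?_ ?_ (N := s₁.nat cHi 0))
      (T' := (P.n + 1) ^ P.B * (400 * (P.n + 1) ^ 2 + 2 + 12) + 20)
    · have := Nat.mul_le_mul_right (400 * (P.n + 1) ^ 2 + 2 + 12) hlev.length_le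
      simp
      omega
    · exact ⟨(Frame.refl _ _).setNat (by simp) _ _, Improves.of_eq (by simp) (by simp) (by simp),
        fun e D h1 h2 => absurd (lt_of_le_of_lt h1 h2) (lt_irrefl _)⟩
    · rintro x st ⟨hf, -⟩
      simp [hf.nat]
    · rintro x st hx1 hx2 hcx ⟨hf, himp, hrel⟩
      obtain ⟨D, hD, -, hmask⟩ := hlev.entry x hx1 hx2
      have hij' : st.nat cVal i = s₁.nat cVal i := himp.val_eq i hij.ne
      refine (relax_spec hP (hs₁.frame hf) (by rw [hf.nat _ (by decide), hf₁.nat _ (by decide), hi])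
        (by rw [hf.nat _ (by decide), hf₁.nat _ (by decide), hj])
        (by rw [hf.nat _ (by decide), hm]) hij hD
        (by rw [hcx, hf.nat _ (by decide), hmask])).imp ?_
      rintro s₂ ⟨hf₂, himp₂, hrel₂⟩
      refine ⟨by rw [hf₂.nat _ (by decide), hcx],
        (hf.trans hf₂ (l := cE :: relaxVars) (by decide) (by decide)).setNat (by simp) _ _,
        (himp.trans himp₂).trans (Improves.of_eq (by simp) (by simp) (by simp)), ?_⟩
      intro e D' he1 he2 hmask' hcov
      rw [State.setNat_nat_of_ne _ _ _ (by decide)]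
      rcases (Nat.lt_succ_iff.1 he2).lt_or_eq with h7 | rfl
      · exact himp₂.le.trans (hrel e D' he1 h7 hmask' hcov)
      · obtain rfl := mask_injective (hmask'.symm.trans hmask)
        rw [← hij']; exact hrel₂ hcov
    · rintro st - ⟨hf, himp, hrel⟩
      refine ⟨hf₁.trans hf (by decide) (by decide), (Improves.of_eq hV hR hS).trans himp, ?_⟩
      intro E hE
      obtain ⟨e, he1, he2, D, h1, h2, h3⟩ := hlev.complete E hE
      obtain ⟨D', h4, h5, h6⟩ := hlev.entry e he1 he2
      obtain rfl := mask_injective (h1.symm.trans h6)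
      -- The final level guarantees coverage only with respect to point `n - 1`; one more
      -- application of `covers_next`, at the sentinel, closes the gap.
      have h7 := hrel e D he1 he2 h1 (hP.covers_next h5 hE h3)
      have h8 := card_filter_le E (· < P.n)
      rw [hV] at h7
      omega
  · have h1 : 1 ≤ (P.n + 1) ^ P.B := Nat.one_le_pow _ _ (by omega)
    have h2 : 1 ≤ (P.n + 1) ^ 2 := Nat.one_le_pow _ _ (by omega)
    generalize (P.n + 1) ^ P.B = N at *
    generalize (P.n + 1) ^ 2 = G at *
    have h3 : N * (G + N) ≤ (P.n + 1) * (N * (G + N)) := Nat.le_mul_of_pos_left _ (by omega)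
    have h4 : 1 ≤ N * N := Nat.mul_le_mul h1 h1
    have h5 : N ≤ N * G := Nat.le_mul_of_pos_right _ h2
    have h6 : N * (400 * G + 2 + 12) = 400 * (N * G) + 14 * N := by ring
    rw [mul_add] at h3 ⊢
    omega

/-- The dynamic program has been run for the ranks up to `m`. -/
structure Table (P : Instance) (m : ℕ) (s : State) : Prop where
  zero : s.nat cVal 0 = 0
  row : ∀ j, 1 ≤ j → j ≤ m → Row P j s
  le : ∀ i j E, i < j → j ≤ m → P.Thin i j E → s.nat cVal j ≤ s.nat cVal i + E.card

lemma Table.congr {P : Instance} {m : ℕ} {s s' : State} (h : Table P m s)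
    (hV : ∀ j ≤ m, s'.nat cVal j = s.nat cVal j) (hR : ∀ j ≤ m, s'.nat cPrev j = s.nat cPrev j)
    (hS : ∀ j ≤ m, s'.nat cSol j = s.nat cSol j) : Table P m s' where
  zero := by rw [hV _ (Nat.zero_le _), h.zero]
  row j h₁ h₂ := (h.row j h₁ h₂).congr (fun i hi => hV i (hi.trans h₂)) (hR j h₂) (hS j h₂)
  le i j E h₁ h₂ h₃ := by rw [hV _ h₂, hV _ (h₁.le.trans h₂)]; exact h.le i j E h₁ h₂ h₃

/-- A bound for the steps taken for a single strip. -/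
def stripTime (n B : ℕ) : ℕ :=
  2000 * ((n + 1) * ((n + 1) ^ B * ((n + 1) ^ 2 + (n + 1) ^ B)))

lemma Improves.table {P : Instance} {j : ℕ} {s s' : State} (h : Improves P (j + 1) s s')
    (ht : Table P j s) : Table P j s' :=
  ht.congr (fun i hi => h.val_eq i (by omega)) (fun i hi => h.prev_eq i (by omega))
    (fun i hi => h.sol_eq i (by omega))

local notation "dpVars" => ([6, 7, 8, 13, 14, 15, 16, 17, 18, 19, 20, 21, 22, 23, 24, 25, 26, 27, 28,
  29, 30, 31, 9, 10, 11, 12] : List ℕ)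

lemma dp_spec {P : Instance} (hP : P.Sorted) {s : State} (hs : Stores P s) :
    Reaches dp s (P.n * (P.n * (stripTime P.n P.B + 20) + 100) + 50) fun s' =>
      Frame dpVars s s' ∧ Table P P.n s' := by
  apply Reaches.of_le
  rotate_left
  · apply Reaches.seq
    apply Reaches.setNat
    refine Reaches.forTo (fun x st => Frame dpVars s st ∧ Table P (x - 1) st) rfl
      (N := P.n + 1) (by simp) ?_ ?_ (T := P.n * (stripTime P.n P.B + 20) + 80) ?_ ?_
    · refine ⟨((Frame.refl _ s).setNat (by simp) _ _).setNat (by simp) _ _, by simp, ?_, ?_⟩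
      · intro j h1 h2; simp at h2; omega
      · intro i j E h1 h2; simp at h2; omega
    · rintro x st ⟨hf, -⟩
      simp [(hs.frame hf).n]
    · rintro j st hj1 hj2 hcj ⟨hf, htab⟩
      have hst := hs.frame hf
      have hj1' : 1 ≤ j := hj1
      obtain ⟨j, rfl⟩ : ∃ j', j = j' + 1 := ⟨j - 1, by omega⟩
      rw [Nat.add_sub_cancel] at htab
      have hpow := hst.pow P.n le_rfl
      apply Reaches.of_le
      rotate_left
      · iterate 3
          apply Reaches.seq
          apply Reaches.setNat
        refine Reaches.forTo (fun i su => Frame dpVars s su ∧ su.nat cJ 0 = j + 1 ∧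
          Table P j su ∧ Row P (j + 1) su ∧
          ∀ i' E, i' < i → P.Thin i' (j + 1) E →
            su.nat cVal (j + 1) ≤ su.nat cVal i' + E.card) rfl
          (Nat.zero_le (j + 1)) ?_ ?_ (T := stripTime P.n P.B) ?_ ?_
        · simp only [NExp.eval, hst.n, hcj]
          simp [hst.n, hcj, hpow]
          -- The initial row for `j + 1` takes all `n` points on top of the empty prefix, so it is
          -- valid before any improvement.
          refine ⟨?_, htab.congr ?_ ?_ ?_, ?_, range P.n, subset_rfl, ?_, ?_, ?_⟩
          · iterate 4 refine Frame.setNat ?_ (by simp) _ _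
            exact hf
          · intro i hi; simp [show i ≠ j + 1 by omega]
          · intro i hi; simp [show i ≠ j + 1 by omega]
          · intro i hi; simp [show i ≠ j + 1 by omega]
          · simp
          · simp [mask_range]
          · simp [htab.zero]
          · intro r hr _ _
            exact ⟨r, mem_range.2 hr, Adj.refl _ _ _⟩
        · rintro i su ⟨-, hju, -⟩
          simpa using hju
        · rintro i su - hi hci ⟨hfu, hju, htabu, hrow, hle⟩
          refine (stripStep_spec hP (hs.frame hfu) hci hju hi).imp ?_
          rintro s₁ ⟨hf₁, himp, hle₁⟩
          refine ⟨by rw [hf₁.nat _ (by decide), hci],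
            (hfu.trans hf₁ (l := dpVars) (by decide) (by decide)).setNat (by simp) _ _,
            by simp [hf₁.nat cJ (by decide), hju],
            (himp.table htabu).congr (by simp) (by simp) (by simp),
            (himp.row hrow).congr (by simp) (by simp) (by simp), ?_⟩
          intro i' E hi' hE
          rw [State.setNat_nat_of_ne _ _ _ (by decide), himp.val_eq i' (by omega)]
          rcases (Nat.lt_succ_iff.1 hi').lt_or_eq with h7 | rfl
          · exact himp.le.trans (hle i' E h7 hE)
          · exact hle₁ E hE
        · rintro su - ⟨hfu, hju, htabu, hrow, hle⟩
          refine ⟨hju, hfu.setNat (by simp) _ _, ?_⟩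
          refine Table.congr (s := su) ⟨htabu.zero, fun j' h1 h2 => ?_, fun i j' E h1 h2 h3 => ?_⟩
            (by simp) (by simp) (by simp)
          · rcases (show j' ≤ j + 1 by omega).eq_or_lt with rfl | h7
            · exact hrow
            · exact htabu.row j' h1 (by omega)
          · rcases (show j' ≤ j + 1 by omega).eq_or_lt with rfl | h7
            · exact hle i E h1 h3
            · exact htabu.le i j' E h1 (by omega) h3
      · simp
        have := Nat.mul_le_mul_right (stripTime P.n P.B + 2 + 12) (show j + 1 ≤ P.n by omega)
        nlinarith
    · rintro st - ⟨hf, h⟩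
      exact ⟨hf, h⟩
  · simp
    nlinarith

/-! ### Recovering the solution -/

/-- Trace back the choices of the dynamic program, and write the union of the sets to the output. -/
def trace : Prog :=
  assign cJ (var 0) ;;
  .loop (.natLe (.const 1) (var cJ))
    (assign cV (.get cSol (var cJ)) ;; scan ;;
    forTo cR (.const 0) (var 0)
      (.ite (.natLe (.const 1) (.get cBit (var cR))) (.setNat cOut (.get cIdx (var cR)) (.const 1))
        .skip) ;;
    assign cJ (.get cPrev (var cJ)))

/-- The sizes telescope along the back pointers: at index `j` the output so far dominates all ranks
from `j` on, and its size plus the table value at `j` is at most the value at `P.n`. -/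
lemma trace_spec {P : Instance} {s : State} (hs : Stores P s) (ht : Table P P.n s)
    (hidx : ∀ r < P.n, ∀ q < P.n, s.nat cIdx r = s.nat cIdx q → r = q)
    (hout : ∀ r < P.n, s.nat cOut (s.nat cIdx r) = 0) (hR : ∀ r < P.n, P.R r < P.n) :
    Reaches trace s (400 * (P.n + 1) ^ 2) fun s' =>
      s'.nat cIdx = s.nat cIdx ∧ ∃ O ⊆ range P.n, O.card ≤ s.nat cVal P.n ∧
        (∀ r < P.n, Dominates P.X P.Y O r) ∧
        ∀ r < P.n, s'.nat cOut (s.nat cIdx r) = 1 ↔ r ∈ O := by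
  let I : ℕ → State → Prop := fun j st => st.nat cJ 0 = j ∧ j ≤ P.n ∧
    Frame [cOut, cJ, cV, cW, cCount, cSg, cSgCount, cX, cD, cBit, cR] s st ∧
    ∃ O ⊆ range P.n, O.card + s.nat cVal j ≤ s.nat cVal P.n ∧
      (∀ r < P.n, j ≤ P.R r → Dominates P.X P.Y O r) ∧
      ∀ r < P.n, st.nat cOut (s.nat cIdx r) = 1 ↔ r ∈ O
  apply Reaches.of_le
  rotate_left
  · apply Reaches.seq
    apply Reaches.setNat
    refine Reaches.loop I (T := 200 * (P.n + 1)) ?_ ?_ P.n ?_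
    · rintro st ⟨hj, -, hf, O, hO, hcard, hdom, hOut⟩
      exact ⟨by simp [hj], hf.nat _ (by decide), O, hO, by omega,
        fun r hr => hdom r hr (Nat.zero_le _), hOut⟩
    · rintro j st ⟨hj, hjn, hf, O, hO, hcard, hdom, hOut⟩
      refine Or.inr ⟨by simp [hj], ?_⟩
      obtain ⟨hlt, D, hD, hmask, hval, hcov⟩ := ht.row (j + 1) (by omega) hjn
      have hst := hs.frame hf
      have hsol : st.nat cSol (j + 1) = mask D := by rw [hf.nat _ (by decide), hmask]
      apply Reaches.of_le
      rotate_left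
      · apply Reaches.seq
        apply Reaches.setNat
        have hf₀ : Frame [cV] st (st.setNat cV ((NExp.const 0).eval st)
            (NExp.eval st (.get cSol (var cJ)))) := (Frame.refl _ st).setNat (by simp) _ _
        apply Reaches.seq
        refine (scan_spec (hst.frame hf₀).n (hst.frame hf₀).pow hD (by simp [hj, hsol])).imp ?_
        rintro s₁ ⟨hf₁, hb, -⟩
        have hf₁' : Frame [cV, cW, cCount, cSg, cSgCount, cX, cD, cBit] st s₁ :=
          hf₀.trans hf₁ (by decide) (by decide)
        have hs₁ := hst.frame hf₁'
        apply Reaches.seq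
        refine Reaches.forTo (fun x su => Frame [cOut, cR] s₁ su ∧
          ∀ r < P.n, su.nat cOut (s.nat cIdx r) = 1 ↔ r ∈ O ∨ (r < x ∧ r ∈ D)) rfl
          (Nat.zero_le P.n) ?_ ?_ (T := 30) ?_ ?_
        · refine ⟨(Frame.refl _ s₁).setNat (by simp) _ _, ?_⟩
          simp [hf₁'.nat cOut (by decide)]
          exact hOut
        · rintro x su ⟨hfu, -⟩
          simp [(hs₁.frame hfu).n]
        · rintro x su - hx hcx ⟨hfu, hou⟩
          have hbu : su.nat cBit x = if x ∈ D then 1 else 0 := by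
            rw [hfu.nat _ (by decide)]; exact hb x hx
          have hiu : su.nat cIdx = s.nat cIdx := by
            rw [hfu.nat _ (by decide), hf₁'.nat _ (by decide), hf.nat _ (by decide)]
          apply Reaches.of_le
          rotate_left
          · apply Reaches.ite
            · intro h
              have hxD : x ∈ D := by by_contra h'; simp [hcx, hbu, h'] at h
              apply Reaches.setNat
              refine ⟨by simp [hcx], (hfu.setNat (by simp) _ _).setNat (by simp) _ _, ?_⟩
              intro r hr
              simp [hcx, hiu, Function.update_apply]
              rcases eq_or_ne r x with rfl | h'
              · simp [hxD]
              · have hne : s.nat cIdx r ≠ s.nat cIdx x := fun h'' => h' (hidx _ hr _ hx h'')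
                simp [hne, hou r hr, h'.le_iff_lt]
            · intro h
              have hxD : x ∉ D := by intro h'; simp [hcx, hbu, h'] at h
              apply Reaches.skip
              refine ⟨hcx, hfu.setNat (by simp) _ _, fun r hr => ?_⟩
              rw [State.setNat_nat_of_ne _ _ _ (by decide), hou r hr]
              refine or_congr Iff.rfl ⟨fun h' => ⟨by omega, h'.2⟩, fun h' => ⟨?_, h'.2⟩⟩
              rcases (Nat.lt_succ_iff.1 h'.1).lt_or_eq with h7 | rfl
              · exact h7
              · exact absurd h'.2 hxD
          · simp
        · rintro su - ⟨hfu, hou⟩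
          apply Reaches.setNat
          have hju : su.nat cJ 0 = j + 1 := by
            rw [hfu.nat _ (by decide), hf₁'.nat _ (by decide), hj]
          have hpu : su.nat cPrev = s.nat cPrev := by
            rw [hfu.nat _ (by decide), hf₁'.nat _ (by decide), hf.nat _ (by decide)]
          -- The back pointer is strictly smaller, possibly by more than one, and the drop in `cVal`
          -- pays for adding `D`.
          refine ⟨s.nat cPrev (j + 1), by omega, by simp [hju, hpu], by omega, ?_, O ∪ D,
            union_subset hO hD, ?_, ?_, ?_⟩
          · refine Frame.setNat ?_ (by simp) _ _
            exact (hf.trans hf₁' (l := [cOut, cJ, cV, cW, cCount, cSg, cSgCount, cX, cD, cBit, cR])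
              (by decide) (by decide)).trans hfu (by decide) (by decide)
          · have := card_union_le O D
            omega
          · intro r hr hRr
            by_cases h : P.R r < j + 1
            · obtain ⟨d, hd, hdr⟩ := hcov r hr hRr h
              exact ⟨d, mem_union_right _ hd, hdr⟩
            · obtain ⟨d, hd, hdr⟩ := hdom r hr (by omega)
              exact ⟨d, mem_union_left _ hd, hdr⟩
          · intro r hr
            rw [State.setNat_nat_of_ne _ _ _ (by decide), hou r hr, mem_union]
            simp [hr]
      · simp
        omega
    · refine ⟨by simp [hs.n], le_rfl, (Frame.refl _ s).setNat (by simp) _ _, ∅, by simp, by simp,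
        fun r hr h => absurd (hR r hr) (by omega), fun r hr => ?_⟩
      simp [hout r hr]
  · simp
    nlinarith

/-! ### Sorting and ranking by counting -/

/-- Count in `cPos` the values of `cD` below the number of points for which the test `b` succeeds. -/
def count (b : BExp) : Prog :=
  assign cPos (.const 0) ;;
  forTo cD (.const 0) (var 0) (.ite b (assign cPos (.add (var cPos) (.const 1))) .skip)

/-- The test is evaluated while `cPos` and `cD` change, so `hb` describes it in all states that
differ from `s` at most there. -/
lemma count_spec {b : BExp} {s : State} {n : ℕ} {p : ℕ → Prop} [DecidablePred p]
    (hn : s.nat 0 0 = n)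
    (hb : ∀ st d, Frame [cPos, cD] s st → d < n → st.nat cD 0 = d → (b.Holds st ↔ p d)) :
    Reaches (count b) s ((n + 1) * (b.cost + 40)) fun s' =>
      Frame [cPos, cD] s s' ∧ s'.nat cPos 0 = ((range n).filter p).card := by
  apply Reaches.of_le
  rotate_left
  · apply Reaches.seq
    apply Reaches.setNat
    refine Reaches.forTo (fun x st => Frame [cPos, cD] s st ∧
      st.nat cPos 0 = ((range x).filter p).card) rfl (Nat.zero_le n) ?_ ?_ (T := b.cost + 10) ?_ ?_
    · exact ⟨((Frame.refl _ s).setNat (by simp) _ _).setNat (by simp) _ _, by simp⟩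
    · rintro x st ⟨hf, -⟩
      simp [hf.nat, hn]
    · rintro x st - hx hcx ⟨hf, hc⟩
      apply Reaches.of_le
      rotate_left
      · apply Reaches.ite
        · intro h
          rw [hb st x hf hx hcx] at h
          apply Reaches.setNat
          refine ⟨by simp [hcx], (hf.setNat (by simp) _ _).setNat (by simp) _ _, ?_⟩
          rw [range_add_one, filter_insert, if_pos h, card_insert_of_notMem (by simp)]
          simp [hc]
        · intro h
          rw [hb st x hf hx hcx] at h
          apply Reaches.skip
          refine ⟨hcx, hf.setNat (by simp) _ _, ?_⟩
          rw [range_add_one, filter_insert, if_neg h]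
          simp [hc]
      · simp
    · rintro st - h
      exact h
  · simp
    nlinarith

/-- Point `d` precedes point `i` in the lexicographic order by abscissa and index. -/
def Precedes (x : ℕ → ℝ) (d i : ℕ) : Prop := ¬ (x i ≤ x d ∧ ¬ (x d ≤ x i ∧ d + 1 ≤ i))

open Classical in
/-- The position of point `i` in the sorted order. -/
noncomputable def position (n : ℕ) (x : ℕ → ℝ) (i : ℕ) : ℕ :=
  ((range n).filter fun d => Precedes x d i).card

/-- The definition copies the shape of the test in `sortPoints`, so that the two agree by `rfl`;
this form is the one suited to reasoning. -/
lemma precedes_iff {x : ℕ → ℝ} {d i : ℕ} :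
    Precedes x d i ↔ (x i ≤ x d → x d ≤ x i ∧ d + 1 ≤ i) := by
  unfold Precedes; tauto

lemma Precedes.trans {x : ℕ → ℝ} {a b c : ℕ} (h : Precedes x a b) (h' : Precedes x b c) :
    Precedes x a c := by
  rw [precedes_iff] at *
  intro hca
  rcases le_total (x b) (x a) with hba | hab
  · have h1 := h hba
    have h2 := h' (hca.trans h1.1)
    exact ⟨h1.1.trans h2.1, by omega⟩
  · rcases le_total (x c) (x b) with hcb | hbc
    · have h2 := h' hcb
      have h1 := h (h2.1.trans hca)
      exact ⟨h1.1.trans h2.1, by omega⟩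
    · have h1 := h (hbc.trans hca)
      have h2 := h' (hca.trans h1.1)
      exact ⟨h1.1.trans h2.1, by omega⟩

lemma position_lt {n : ℕ} {x : ℕ → ℝ} {a b : ℕ} (ha : a < n) (h : Precedes x a b) :
    position n x a < position n x b := by
  classical
  refine card_lt_card ⟨fun d hd => ?_, fun hsub => ?_⟩
  · simp only [mem_filter] at hd ⊢
    exact ⟨hd.1, hd.2.trans h⟩
  · have := hsub (mem_filter.2 ⟨mem_range.2 ha, h⟩)
    simp [Precedes] at this

/-- Ties between abscissae are broken by the index, which makes the order total and `position` a
permutation of `range n`. -/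
lemma precedes_or_precedes {x : ℕ → ℝ} {a b : ℕ} (h : a ≠ b) : Precedes x a b ∨ Precedes x b a := by
  simp only [precedes_iff]
  rcases lt_or_gt_of_ne h with h' | h' <;> rcases lt_trichotomy (x a) (x b) with h1 | h1 | h1 <;>
    first
    | exact Or.inl fun h2 => absurd h2 (not_le.2 h1)
    | exact Or.inr fun h2 => absurd h2 (not_le.2 h1)
    | exact Or.inl fun _ => ⟨h1.le, h'⟩
    | exact Or.inr fun _ => ⟨h1.ge, h'⟩

lemma position_injective {n : ℕ} {x : ℕ → ℝ} {a b : ℕ} (ha : a < n) (hb : b < n)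
    (h : position n x a = position n x b) : a = b := by
  by_contra hab
  rcases precedes_or_precedes (x := x) hab with h' | h'
  · exact absurd h (position_lt ha h').ne
  · exact absurd h.symm (position_lt hb h').ne

lemma position_lt_n {n : ℕ} {x : ℕ → ℝ} {a : ℕ} (ha : a < n) : position n x a < n := by
  classical
  refine (card_lt_card (filter_ssubset.2 ⟨a, mem_range.2 ha, ?_⟩)).trans_eq (card_range n)
  simp [Precedes]

lemma exists_position_eq {n : ℕ} {x : ℕ → ℝ} {r : ℕ} (hr : r < n) : ∃ a < n, position n x a = r := by
  have h : (range n).image (position n x) = range n := by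
    refine eq_of_subset_of_card_le (fun r hr => ?_) ?_
    · obtain ⟨a, ha, rfl⟩ := mem_image.1 hr
      exact mem_range.2 (position_lt_n (mem_range.1 ha))
    · rw [card_image_of_injOn]
      exact fun a ha b hb h => position_injective (by simpa using ha) (by simpa using hb) h
  obtain ⟨a, ha, h'⟩ := mem_image.1 (h ▸ mem_range.2 hr)
  exact ⟨a, mem_range.1 ha, h'⟩

/-- Sort the input points by abscissa, and place a sentinel. -/
def sortPoints : Prog :=
  forTo cR (.const 0) (var 0)
    (count (.not (.and (.realLe (.get 0 (var cR)) (.get 0 (var cD)))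
      (.not (.and (.realLe (.get 0 (var cD)) (.get 0 (var cR)))
        (.natLe (.add (var cD) (.const 1)) (var cR)))))) ;;
    .setReal rX (var cPos) (.get 0 (var cR)) ;; .setReal rY (var cPos) (.get 1 (var cR)) ;;
    .setNat cIdx (var cPos) (var cR)) ;;
  .setReal rX (var 0) (.add (.get rX (.sub (var 0) (.const 1))) (.ofNat (.const 2)))

lemma sortPoints_spec {s : State} {n : ℕ} (hn : s.nat 0 0 = n) :
    Reaches sortPoints s (200 * (n + 1) ^ 2) fun s' =>
      (∀ a, a ∉ [cIdx, cPos, cD, cR] → s'.nat a = s.nat a) ∧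
      (0 < n → s'.real rX n = s'.real rX (n - 1) + 2) ∧
      ∀ i < n, s'.real rX (position n (s.real 0) i) = s.real 0 i ∧
        s'.real rY (position n (s.real 0) i) = s.real 1 i ∧
        s'.nat cIdx (position n (s.real 0) i) = i := by
  classical
  set x := s.real 0 with hx
  apply Reaches.of_le
  rotate_left
  · apply Reaches.seq
    refine Reaches.forTo (fun m st => (∀ a, a ∉ [cIdx, cPos, cD, cR] → st.nat a = s.nat a) ∧
      st.real 0 = x ∧ st.real 1 = s.real 1 ∧
      ∀ i < m, st.real rX (position n x i) = x i ∧ st.real rY (position n x i) = s.real 1 i ∧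
        st.nat cIdx (position n x i) = i) rfl (Nat.zero_le n) ?_ ?_ (T := 80 * (n + 1)) ?_ ?_
    · refine ⟨?_, rfl, rfl, by simp⟩
      intro a ha
      rw [State.setNat_nat_of_ne _ _ _ (ne_of_mem_of_not_mem (by simp) ha).symm]
    · rintro m st ⟨hf, -⟩
      simp [hf, hn]
    · rintro m st - hm hcm ⟨hf, hx0, hx1, hpos⟩
      apply Reaches.of_le
      rotate_left
      · apply Reaches.seq
        refine (count_spec (n := n) (p := fun d => Precedes x d m) (by rw [hf _ (by decide), hn])
          ?_).imp ?_
        · intro su d hsu hd hcd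
          have hcm' : su.nat cR 0 = m := by rw [hsu.nat _ (by decide), hcm]
          simp only [BExp.Holds, RExp.eval, NExp.eval, hcm', hcd, hsu.real, hx0]
          rfl
        · rintro su ⟨hfu, hcu⟩
          change su.nat cPos 0 = position n x m at hcu
          have hcm' : su.nat cR 0 = m := by rw [hfu.nat _ (by decide), hcm]
          apply Reaches.seq
          apply Reaches.setReal
          apply Reaches.seq
          apply Reaches.setReal
          apply Reaches.setNat
          refine ⟨by simp [hcm'], ?_, by simp [hfu.real, hx0], by simp [hfu.real, hx1], ?_⟩
          · intro a ha
            simp at ha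
            simp [ha, hfu.nat a (by simp [ha]), hf a (by simp [ha])]
          · intro i hi
            simp [hcu, hcm', hfu.real, hx0, hx1]
            rcases (Nat.lt_succ_iff.1 hi).lt_or_eq with h7 | rfl
            · have hne : position n x i ≠ position n x m := fun h =>
                h7.ne (position_injective (by omega) hm h)
              simp only [Function.update_of_ne hne, hfu.nat cIdx (by decide)]
              exact hpos i h7
            · simp
      · simp
        omega
    · rintro st - ⟨hf, hx0, hx1, hpos⟩
      have hst : st.nat 0 0 = n := by rw [hf _ (by decide), hn]
      apply Reaches.setReal
      refine ⟨hf, fun h => ?_, fun i hi => ?_⟩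
      · have hne : n - 1 ≠ n := by omega
        simp [hst, hne]
      · have hne : position n x i ≠ n := (position_lt_n hi).ne
        simpa [hst, hne] using hpos i hi
  · simp
    ring_nf
    nlinarith

/-- Compute the ranks of the ordinates. -/
def rankPoints : Prog :=
  forTo cR (.const 0) (var 0)
    (count (.not (.realLe (.get rY (var cR)) (.get rY (var cD)))) ;;
    .setNat cRank (var cR) (var cPos))

lemma rankPoints_spec {s : State} {n : ℕ} (hn : s.nat 0 0 = n) :
    Reaches rankPoints s (200 * (n + 1) ^ 2) fun s' => Frame [cRank, cR, cPos, cD] s s' ∧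
      ∀ r < n, s'.nat cRank r =
        ((range n).filter fun q => ¬ s.real rY r ≤ s.real rY q).card := by
  classical
  apply Reaches.of_le
  rotate_left
  · refine Reaches.forTo (fun m st => Frame [cRank, cR, cPos, cD] s st ∧ ∀ r < m, st.nat cRank r =
        ((range n).filter fun q => ¬ s.real rY r ≤ s.real rY q).card) rfl (Nat.zero_le n) ?_ ?_
        (T := 80 * (n + 1)) ?_ ?_
    · exact ⟨(Frame.refl _ s).setNat (by simp) _ _, by simp⟩
    · rintro m st ⟨hf, -⟩
      simp [hf.nat, hn]
    · rintro m st - hm hcm ⟨hf, hrank⟩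
      apply Reaches.of_le
      rotate_left
      · apply Reaches.seq
        refine (count_spec (n := n) (p := fun q => ¬ s.real rY m ≤ s.real rY q)
          (by rw [hf.nat _ (by decide), hn]) ?_).imp ?_
        · intro su d hsu hd hcd
          have hcm' : su.nat cR 0 = m := by rw [hsu.nat _ (by decide), hcm]
          simp only [BExp.Holds, RExp.eval, NExp.eval, hcm', hcd, hsu.real, hf.real]
        · rintro su ⟨hfu, hcu⟩
          have hcm' : su.nat cR 0 = m := by rw [hfu.nat _ (by decide), hcm]
          apply Reaches.setNat
          refine ⟨by simp [hcm'], ?_, ?_⟩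
          · iterate 2 refine Frame.setNat ?_ (by simp) _ _
            exact hf.trans hfu (by decide) (by decide)
          · intro r hr
            simp [hcu, hcm', hfu.nat cRank (by decide)]
            rcases (Nat.lt_succ_iff.1 hr).lt_or_eq with h7 | rfl
            · simpa [h7.ne] using hrank r h7
            · simp
      · simp
        omega
    · rintro st - h
      exact h
  · simp
    nlinarith

/-! ### Tables of constants -/

/-- Compute the powers of `2`. -/
def powers : Prog :=
  .setNat cPow (.const 0) (.const 1) ;;
  forTo cR (.const 0) (var 0)
    (.setNat cPow (.add (var cR) (.const 1)) (.add (.get cPow (var cR)) (.get cPow (var cR))))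

lemma powers_spec {s : State} {n : ℕ} (hn : s.nat 0 0 = n) :
    Reaches powers s (100 * (n + 1)) fun s' => Frame [cPow, cR] s s' ∧
      ∀ i ≤ n, s'.nat cPow i = 2 ^ i := by
  apply Reaches.of_le
  rotate_left
  · apply Reaches.seq
    apply Reaches.setNat
    refine Reaches.forTo (fun m st => Frame [cPow, cR] s st ∧ ∀ i ≤ m, st.nat cPow i = 2 ^ i) rfl
      (Nat.zero_le n) ?_ ?_ (T := 30) ?_ ?_
    · exact ⟨((Frame.refl _ s).setNat (by simp) _ _).setNat (by simp) _ _, by simp⟩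
    · rintro m st ⟨hf, -⟩
      simp [hf.nat, hn]
    · rintro m st - hm hcm ⟨hf, hpow⟩
      apply Reaches.of_le
      rotate_left
      · apply Reaches.setNat
        refine ⟨by simp [hcm], (hf.setNat (by simp) _ _).setNat (by simp) _ _, fun i hi => ?_⟩
        rcases hi.lt_or_eq with h | rfl
        · simpa [hcm, h.ne] using hpow i (by omega)
        · simp [hcm, hpow m le_rfl, pow_succ, mul_two]
      · simp
    · rintro st - h
      exact h
  · simp
    omega

/-- Compute the bound `64 * k` for the windows. -/
def windowBound : Prog :=
  assign cBound (.get 0 (.const 1)) ;;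
  assign cBound (.add (var cBound) (var cBound)) ;;
  assign cBound (.add (var cBound) (var cBound)) ;;
  assign cBound (.add (var cBound) (var cBound)) ;;
  assign cBound (.add (var cBound) (var cBound)) ;;
  assign cBound (.add (var cBound) (var cBound)) ;;
  assign cBound (.add (var cBound) (var cBound))

lemma windowBound_spec (s : State) :
    Reaches windowBound s 100 fun s' => Frame [cBound] s s' ∧
      s'.nat cBound 0 = 64 * s.nat 0 1 := by
  apply Reaches.of_le
  rotate_left
  · iterate 6
      apply Reaches.seq
      apply Reaches.setNat
    apply Reaches.setNat
    refine ⟨?_, ?_⟩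
    · iterate 7 refine Frame.setNat ?_ (by simp) _ _
      exact Frame.refl _ s
    · simp
      omega
  · simp

/-! ### Assembly and running time -/

/-- The approximation scheme. -/
def approxScheme : Prog :=
  windowBound ;; powers ;; sortPoints ;; rankPoints ;; dp ;; trace

lemma dist_le_one_iff (a b : Plane) :
    dist a b ≤ 1 ↔ (a 0 - b 0) * (a 0 - b 0) + (a 1 - b 1) * (a 1 - b 1) ≤ 1 := by
  rw [EuclideanSpace.dist_eq, Real.sqrt_le_iff, Fin.sum_univ_two, Real.dist_eq, Real.dist_eq,
    sq_abs, sq_abs, sq, sq]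
  simp

lemma sorted_of_position {n B : ℕ} {x X Y : ℕ → ℝ} {R : ℕ → ℕ}
    (hX : ∀ i < n, X (position n x i) = x i) (hn : 0 < n → X n = X (n - 1) + 2) :
    (Instance.mk n X Y R B).Sorted := by
  have hmono : ∀ a b, a ≤ b → b < n → X a ≤ X b := by
    intro a b hab hb
    obtain ⟨i, hi, rfl⟩ := exists_position_eq (x := x) (lt_of_le_of_lt hab hb)
    obtain ⟨j, hj, rfl⟩ := exists_position_eq (x := x) hb
    rw [hX i hi, hX j hj]
    by_contra! h
    exact absurd (position_lt hj (precedes_iff.2 fun h' => absurd h' (not_le.2 h))) (not_lt.2 hab)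
  have hsent : ∀ r < n, X r + 2 ≤ X n := fun r hr => by
    rw [hn (by omega)]
    linarith [hmono r (n - 1) (by omega) (by omega)]
  refine ⟨fun a b hab hb => ?_, hsent⟩
  change b ≤ n at hb
  rcases hb.lt_or_eq with h | rfl
  · exact hmono a b hab h
  · rcases hab.lt_or_eq with h | rfl
    · linarith [hsent a h]
    · exact le_rfl

/-- Everything is expressed through `M`, using `n + 1 ≤ M ^ 2` and `6000 ≤ 2 ^ 13`. The exponent
becomes `23 + 256 * k`, which is at most `300 * k`. -/
lemma time_bound {n k t : ℕ} (hk : 1 ≤ k)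
    (ht : t ≤ 6000 * ((n + 1) ^ 5 * ((n + 1) ^ (64 * k)) ^ 2)) : t ≤ max n 2 ^ (300 * k) := by
  set M := max n 2 with hM
  have h2 : 2 ≤ M := le_max_right _ _
  have hn : n + 1 ≤ M ^ 2 := by
    have : n ≤ M := le_max_left _ _
    nlinarith
  calc t ≤ 6000 * ((n + 1) ^ 5 * ((n + 1) ^ (64 * k)) ^ 2) := ht
    _ ≤ M ^ 13 * ((M ^ 2) ^ 5 * ((M ^ 2) ^ (64 * k)) ^ 2) := by
        gcongr
        exact le_trans (by norm_num) (Nat.pow_le_pow_left h2 13)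
    _ = M ^ (13 + (2 * 5 + 2 * (64 * k) * 2)) := by
        rw [← pow_mul, ← pow_mul, ← pow_mul, ← pow_add, ← pow_add]
        congr 1; ring
    _ ≤ M ^ (300 * k) := Nat.pow_le_pow_right (by omega) (by omega)

/-- What the approximation scheme achieves, in terms of the input arrays. -/
lemma approxScheme_spec {s : State} {n k : ℕ} (hn : s.nat 0 0 = n) (hk : s.nat 0 1 = k)
    (hk₁ : 1 ≤ k) (hout : ∀ i < n, s.nat cOut i = 0) :
    Reaches approxScheme s (6000 * ((n + 1) ^ 5 * ((n + 1) ^ (64 * k)) ^ 2)) fun s' =>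
      ∃ O ⊆ range n, (∀ i < n, s'.nat cOut i = 1 ↔ i ∈ O) ∧
        (∀ i < n, Dominates (s.real 0) (s.real 1) O i) ∧
        ∀ E ⊆ range n, (∀ i < n, Dominates (s.real 0) (s.real 1) E i) →
          k * O.card ≤ (k + 1) * E.card := by
  classical
  set x := s.real 0 with hx
  set y := s.real 1 with hy
  apply Reaches.of_le
  rotate_left
  · apply Reaches.seq
    refine (windowBound_spec s).imp ?_
    rintro s₁ ⟨hf₁, hB⟩
    apply Reaches.seq
    refine (powers_spec (n := n) (by rw [hf₁.nat _ (by decide), hn])).imp ?_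
    rintro s₂ ⟨hf₂, hpow⟩
    have hF₂ : Frame [cBound, cPow, cR] s s₂ := hf₁.trans hf₂ (by decide) (by decide)
    apply Reaches.seq
    refine (sortPoints_spec (n := n) (by rw [hF₂.nat _ (by decide), hn])).imp ?_
    rintro s₃ ⟨hf₃, hsent, hpos⟩
    rw [hF₂.real, ← hx, ← hy] at hpos
    apply Reaches.seq
    refine (rankPoints_spec (n := n) (by rw [hf₃ _ (by decide), hF₂.nat _ (by decide), hn])).imp ?_
    rintro s₄ ⟨hf₄, hrank⟩
    have hidx₄ : s₄.nat cIdx = s₃.nat cIdx := hf₄.nat _ (by decide)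
    have hout₄ : s₄.nat cOut = s.nat cOut := by
      rw [hf₄.nat _ (by decide), hf₃ _ (by decide), hF₂.nat _ (by decide)]
    let P : Instance := ⟨n, s₃.real rX, s₃.real rY, s₄.nat cRank, 64 * k⟩
    have hP : P.Sorted := sorted_of_position (fun i hi => (hpos i hi).1) hsent
    have hs : Stores P s₄ :=
      { n := by rw [hf₄.nat _ (by decide), hf₃ _ (by decide), hF₂.nat _ (by decide), hn]
        pow := by rw [hf₄.nat _ (by decide), hf₃ _ (by decide)]; exact hpow
        rank := rfl
        bound := by
          rw [hf₄.nat _ (by decide), hf₃ _ (by decide), hf₂.nat _ (by decide), hB, hk]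
        X := by rw [hf₄.real]
        Y := by rw [hf₄.real] }
    have hR : ∀ r < n, P.R r = ((range n).filter fun q => P.Y q < P.Y r).card := by
      intro r hr
      simp only [P, hrank r hr, not_le]
    have hRlt : ∀ r < n, P.R r < n := fun r hr => by
      rw [hR r hr]
      refine (card_lt_card (filter_ssubset.2 ⟨r, mem_range.2 hr, ?_⟩)).trans_eq (card_range n)
      simp
    have hidx : ∀ r < n, ∃ i < n, position n x i = r ∧ s₃.nat cIdx r = i := fun r hr => by
      obtain ⟨i, hi, rfl⟩ := exists_position_eq (x := x) hr
      exact ⟨i, hi, rfl, (hpos i hi).2.2⟩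
    have hadj : ∀ i < n, ∀ j < n,
        Adj P.X P.Y (position n x i) (position n x j) ↔ Adj x y i j := fun i hi j hj => by
      obtain ⟨h1, h2, -⟩ := hpos i hi
      obtain ⟨h3, h4, -⟩ := hpos j hj
      simp only [Adj, P, h1, h2, h3, h4]
    apply Reaches.seq
    refine (dp_spec hP hs).mono (T' := n * (n * (stripTime n (64 * k) + 20) + 100) + 50) le_rfl ?_
    rintro s₅ ⟨hf₅, ht⟩
    have hidx₅ : s₅.nat cIdx = s₃.nat cIdx := by rw [hf₅.nat _ (by decide), hidx₄]
    have hout₅ : s₅.nat cOut = s.nat cOut := by rw [hf₅.nat _ (by decide), hout₄]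
    refine (trace_spec (hs.frame hf₅) ht ?_ ?_ hRlt).mono (T' := 400 * (n + 1) ^ 2) le_rfl ?_
    · intro r hr q hq hrq
      obtain ⟨i, hi, rfl, hi'⟩ := hidx r hr
      obtain ⟨j, hj, rfl, hj'⟩ := hidx q hq
      rw [hidx₅, hi', hj'] at hrq
      rw [hrq]
    · intro r hr
      obtain ⟨i, hi, rfl, hi'⟩ := hidx r hr
      rw [hidx₅, hi', hout₅, hout i hi]
    · rintro s₆ ⟨-, O, hO, hcard, hdom, hO'⟩
      rw [hidx₅] at hO'
      refine ⟨(range n).filter fun i => position n x i ∈ O, filter_subset _ _, fun i hi => ?_,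
        fun i hi => ?_, fun E hE hEdom => ?_⟩
      · have := hO' (position n x i) (position_lt_n hi)
        rw [(hpos i hi).2.2] at this
        simp [this, hi]
      · obtain ⟨d, hd, hdi⟩ := hdom (position n x i) (position_lt_n hi)
        obtain ⟨j, hj, rfl⟩ := exists_position_eq (x := x) (mem_range.1 (hO hd))
        exact ⟨j, mem_filter.2 ⟨mem_range.2 hj, hd⟩, (hadj j hj i hi).1 hdi⟩
      -- The competitor `E` is carried over to sorted indices; `ht.le` is precisely the recursive
      -- inequality that the analysis asks of the table.
      · have h1 := strip_dp_le hk₁ (fun a b hab hb => hP.mono a b hab hb.le) hR ht.zero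
          (fun i j D hij hj hD => ht.le i j D hij hj hD) (D₀ := E.image (position n x))
          (fun r hr => by
            obtain ⟨i, hi, rfl⟩ := mem_image.1 hr
            exact mem_range.2 (position_lt_n (mem_range.1 (hE hi))))
          (fun r hr => by
            obtain ⟨i, hi, rfl⟩ := exists_position_eq (x := x) hr
            obtain ⟨d, hd, hdi⟩ := hEdom i hi
            exact ⟨_, mem_image_of_mem _ hd, (hadj d (mem_range.1 (hE hd)) i hi).2 hdi⟩)
        have h2 : ((range n).filter fun i => position n x i ∈ O).card ≤ O.card :=
          card_le_card_of_injOn (position n x) (fun i hi => (mem_filter.1 hi).2)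
            fun i hi j hj h => position_injective (by simp at hi; exact hi.1)
              (by simp at hj; exact hj.1) h
        calc _ ≤ k * s₅.nat cVal n := Nat.mul_le_mul_left _ (h2.trans hcard)
          _ ≤ (k + 1) * (E.image (position n x)).card := h1
          _ ≤ _ := Nat.mul_le_mul_left _ card_image_le
  · simp only [stripTime]
    have h1 : 1 ≤ (n + 1) ^ (64 * k) := Nat.one_le_pow _ _ (by omega)
    generalize (n + 1) ^ (64 * k) = Z at *
    obtain ⟨a, ha⟩ : ∃ a, n + 1 = a := ⟨_, rfl⟩
    have hna : n ≤ a := by omega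
    have ha1 : 1 ≤ a := by omega
    rw [ha]
    have h2 : 1 ≤ Z ^ 2 := Nat.one_le_pow _ _ h1
    have h3 : a ^ 2 ≤ a ^ 5 * Z ^ 2 :=
      (Nat.pow_le_pow_right ha1 (by norm_num)).trans (Nat.le_mul_of_pos_right _ h2)
    have h4 : a ≤ a ^ 2 := Nat.le_self_pow two_ne_zero _
    have h5 : n * n ≤ a ^ 2 := by rw [sq]; exact Nat.mul_le_mul hna hna
    have h6 : a ^ 2 + Z ≤ 2 * (a ^ 2 * Z) := by nlinarith
    have h7 : n * n * (a * (Z * (a ^ 2 + Z))) ≤ 2 * (a ^ 5 * Z ^ 2) :=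
      calc _ ≤ a ^ 2 * (a * (Z * (2 * (a ^ 2 * Z)))) := by gcongr
        _ = _ := by ring
    have h8 : n * (n * (2000 * (a * (Z * (a ^ 2 + Z))) + 20) + 100) =
        2000 * (n * n * (a * (Z * (a ^ 2 + Z)))) + 20 * (n * n) + 100 * n := by ring
    rw [h8]
    omega

end RealRAM

open RealRAM StripDominating in
theorem theorem5 :
    ∃ (A : RealRAM.Prog) (C : ℕ), ∀ (k : ℕ), 1 ≤ k → ∀ (n : ℕ) (p : Fin n ↪ Plane),
      ∃ (t : ℕ) (s : RealRAM.State),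
        RealRAM.Runs A (RealRAM.input k p) t s ∧
        t ≤ (max n 2) ^ (C * k) ∧
        IsDominatingSet (Finset.univ.map p) (RealRAM.output p s) ∧
        ∀ OPT : Finset Plane, IsMinimumDominatingSet (Finset.univ.map p) OPT →
          ((RealRAM.output p s).card : ℝ) ≤ (1 + 1 / (k : ℝ)) ^ 2 * (OPT.card : ℝ) := by
  refine ⟨approxScheme, 300, fun k hk n p => ?_⟩
  obtain ⟨t, s, hrun, ht, O, hO, hout, hdom, hopt⟩ := approxScheme_spec (s := input k p) (n := n)
    (k := k) (by simp [input]) (by simp [input]) hk (by simp [input])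
  have hadj : ∀ i j (hi : i < n) (hj : j < n), Adj ((input k p).real 0) ((input k p).real 1) i j ↔
      dist (p ⟨i, hi⟩) (p ⟨j, hj⟩) ≤ 1 := fun i j hi hj => by
    rw [dist_le_one_iff]
    simp [Adj, input, hi, hj]
  have hmem : ∀ i : Fin n, p i ∈ output p s ↔ (i : ℕ) ∈ O := fun i => by
    simp [output, hout i i.2]
  refine ⟨t, s, hrun, time_bound hk ht, ⟨Finset.map_subset_map.2 (Finset.filter_subset _ _), ?_⟩, ?_⟩
  · intro q hq
    obtain ⟨i, -, rfl⟩ := Finset.mem_map.1 hq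
    obtain ⟨d, hd, hdi⟩ := hdom i i.2
    have hdn := Finset.mem_range.1 (hO hd)
    exact ⟨p ⟨d, hdn⟩, (hmem ⟨d, hdn⟩).2 hd, by rw [dist_comm]; exact (hadj d i hdn i.2).1 hdi⟩
  · rintro OPT ⟨⟨hsub, hcov⟩, -⟩
    classical
    let E : Finset ℕ := (Finset.univ.filter fun i : Fin n => p i ∈ OPT).map Fin.valEmbedding
    have hE : E.card ≤ OPT.card := by
      rw [Finset.card_map]
      exact Finset.card_le_card_of_injOn p (fun i hi => (Finset.mem_filter.1 hi).2)
        p.injective.injOn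
    have hcard : (output p s).card ≤ O.card := by
      rw [output, Finset.card_map]
      exact Finset.card_le_card_of_injOn Fin.val
        (fun i hi => (hout i i.2).1 (Finset.mem_filter.1 hi).2) Fin.val_injective.injOn
    have h := hopt E
      (fun i hi => by
        obtain ⟨j, -, rfl⟩ := Finset.mem_map.1 hi
        exact Finset.mem_range.2 j.2)
      (fun i hi => by
        obtain ⟨d, hd, hdist⟩ := hcov (p ⟨i, hi⟩) (Finset.mem_map_of_mem _ (Finset.mem_univ _))
        obtain ⟨j, -, rfl⟩ := Finset.mem_map.1 (hsub hd)
        exact ⟨j, Finset.mem_map.2 ⟨j, by simpa using hd, rfl⟩,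
          (hadj j i j.2 hi).2 (by rw [dist_comm]; exact hdist)⟩)
    have h' : k * (output p s).card ≤ (k + 1) * OPT.card :=
      (Nat.mul_le_mul_left _ hcard).trans (h.trans (Nat.mul_le_mul_left _ hE))
    have hk₀ : (0 : ℝ) < k := by exact_mod_cast hk
    have h'' : (k : ℝ) * (output p s).card ≤ (k + 1) * OPT.card := by exact_mod_cast h'
    have h₁ : ((output p s).card : ℝ) ≤ (1 + 1 / (k : ℝ)) * OPT.card := by
      rw [← mul_le_mul_iff_right₀ hk₀]
      refine h''.trans_eq ?_
      field_simp
    -- One factor `1 + 1 / k` is already established, and the second is at least 1.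
    refine h₁.trans (mul_le_mul_of_nonneg_right ?_ (Nat.cast_nonneg _))
    have : (0 : ℝ) < 1 / k := by positivity
    nlinarith
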